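/- Let $\mathcal A$ be a finite set, $\Sigma=\mathcal A^{\mathbb N}$ with the product topology (of the discrete topology on $\mathcal A$), $\sigma$ the left shift, $\Sigma^*$ the set of finite words over $\mathcal A$, $\omega|_n$ the prefix of length $n$ of $\omega\in\Sigma$, $\omega\wedge\tau$ the longest common prefix of $\omega\ne\tau$, and $[w]\subset\Sigma$ the cylinder of sequences starting with the word $w$. Let $\mathcal E_\sigma(\Sigma)$ be the set of ergodic shift-invariant Borel probability measures on $\Sigma$. For finite Borel measures $\mu,\nu$ on a metric space $(X,\rho)$, with open balls $B(x,r)$, put \[ \dim(\mu\|\nu,\rho)=\inf\Big\{\varepsilon>0:\ -\varepsilon<\operatorname*{ess\,inf}_{x\sim\mu}\liminf_{r\to0}\tfrac{\log\frac{\mu(B(x,r))}{\nu(B(x,r))}}{\log r}\le\operatorname*{ess\,sup}_{x\sim\mu}\limsup_{r\to0}\tfrac{\log\frac{\mu(B(x,r))}{\nu(B(x,r))}}{\log r}<\varepsilon\Big\}, \] where $\log\frac{\mu(B(x,r))}{0}=+\infty$ if $\mu(B(x,r))>0$, and $\inf\emptyset=\infty$. A collection $\mathcal M$ of finite Borel measures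 on $X$ is relative dimension separable with respect to $\rho$ if there is a countable set $\mathcal V$ of finite Borel measures on $X$ (a witness) such that for every $\mu\in\mathcal M$ and $\varepsilon>0$ there is $\nu\in\mathcal V$ with $\dim(\mu\|\nu,\rho)<\varepsilon$. For $k\ge1$, a shift-invariant Borel probability measure $\nu$ on $\Sigma$ is a $k$-step Markov measure if $\nu([\omega_1\dots\omega_n])=\nu([\omega_1\dots\omega_k])\prod_{j=1}^{n-k}P_\nu(\omega_{j+k}\mid\omega_j\dots\omega_{j+k-1})$ for all $n\ge k$ and all words of length $n$, where $P_\nu(a\mid w)=\nu([wa])/\nu([w])$ if $\nu([w])>0$ and $P_\nu(a\mid w)=0$ otherwise ($w\in\mathcal A^k$, $a\in\mathcal A$). Let $\mathcal V_0\subset\mathcal E_\sigma(\Sigma)$ be the set of ergodic measures that are, for some $k\ge1$, $k$-step Markov with all values of $P_\nu$ on $\mathcal A^k\times\mathcal A$ rational. Consider the following condition on a metric $\rho$ on $\Sigma$: $(*)$ there are $\psi:\Sigma^*\to(0,\infty)$ and $\gamma\in(0,1)$ such that $\rho(\omega,\tau)=\psi(\omega\wedge\tau)$ for all $\omega\neq\tau$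 in $\Sigma$, and $\psi(\omega|_{n+1})\le\gamma\,\psi(\omega|_n)$ for all $n\ge1$, $\omega\in\Sigma$. (1) If $\rho$ is a metric on $\Sigma$ satisfying $(*)$, then $\mathcal E_\sigma(\Sigma)$ is relative dimension separable with respect to $\rho$, and $\mathcal V_0$ is a witness; in particular $\mathcal V_0$ is countable. (2) Let $V\subset\mathbb R^n$ be a non-empty compact connected set with $V=\overline{\operatorname{Int}V}$, and let $\mathcal F=(f_i)_{i\in\mathcal A}$ be a conformal $C^{1+\theta}$ IFS on $V$. That is, each $f_i:V\to V$ extends to a $C^1$ diffeomorphism of an open connected set $W_i\supset V$ onto its image, which is contained in $W_i$; for $x\in V$ the differential $f_i'(x)$ is a non-singular similitude with $0<\|f_i'(x)\|<1$; and $x\mapsto f_i'(x)$ is Hölder continuous on $V$ with some positive exponent. For a word $w=w_1\dots w_k$ let $f_w=f_{w_1}\circ\dots\circ f_{w_k}$, and put $\rho_{\mathcal F}(\omega,\tau)=\sup_{x\in V}\|f_{\omega\wedge\tau}'(x)\|$ for $\omega\ne\tau$ and $\rho_{\mathcal F}(\omega,\omega)=0$. Then $\rho_{\mathcal F}$ is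 a metric on $\Sigma$ satisfying $(*)$; consequently $\mathcal E_\sigma(\Sigma)$ is relative dimension separable with respect to $\rho_{\mathcal F}$, and $\mathcal V_0$ is a witness. -/

import Mathlib

open Filter Topology MeasureTheory Set

namespace RelativeDimension

/-! ### Metrics and the relative dimension of measures -/

/-- `ρ` is a metric on `X`. -/
structure IsMetric {X : Type*} (ρ : X → X → ℝ) : Prop where
  eq_zero_iff : ∀ x y, ρ x y = 0 ↔ x = y
  symm : ∀ x y, ρ x y = ρ y x
  triangle : ∀ x y z, ρ x z ≤ ρ x y + ρ y z

/-- The open `r`-ball around `x` in the metric `ρ`. -/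
def ball {X : Type*} (ρ : X → X → ℝ) (x : X) (r : ℝ) : Set X := {y | ρ x y < r}

/-- The ratio `log (μ(B(x,r)) / ν(B(x,r))) / log r`, as an extended real number.
The quotient is taken in `[0,∞]` and the logarithm is `[-∞,∞]`-valued, so that
`log (μ(B(x,r)) / 0) = +∞` if `μ(B(x,r)) > 0`. -/
noncomputable def logRatio {X : Type*} [MeasurableSpace X] (ρ : X → X → ℝ) (μ ν : Measure X)
    (x : X) (r : ℝ) : EReal :=
  ENNReal.log (μ (ball ρ x r) / ν (ball ρ x r)) / ((Real.log r : ℝ) : EReal)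

/-- The relative dimension `dim(μ || ν, ρ)`, with values in the extended reals (`inf ∅ = ∞`). -/
noncomputable def relDim {X : Type*} [MeasurableSpace X] (ρ : X → X → ℝ) (μ ν : Measure X) :
    EReal :=
  sInf ((fun ε : ℝ => (ε : EReal)) '' {ε : ℝ | 0 < ε ∧
    -(ε : EReal) < essInf (fun x => liminf (fun r : ℝ => logRatio ρ μ ν x r) (𝓝[>] 0)) μ ∧
    essInf (fun x => liminf (fun r : ℝ => logRatio ρ μ ν x r) (𝓝[>] 0)) μ ≤
      essSup (fun x => limsup (fun r : ℝ => logRatio ρ μ ν x r) (𝓝[>] 0)) μ ∧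
    essSup (fun x => limsup (fun r : ℝ => logRatio ρ μ ν x r) (𝓝[>] 0)) μ < (ε : EReal)})

/-- `V` is a countable set of finite measures such that every `μ ∈ M` has elements of `V` at
arbitrarily small relative dimension. -/
structure WitnessesRelDimSeparability {X : Type*} [MeasurableSpace X] (ρ : X → X → ℝ)
    (M V : Set (Measure X)) : Prop where
  countable : V.Countable
  finite : ∀ ν ∈ V, IsFiniteMeasure ν
  approx : ∀ μ ∈ M, ∀ ε : ℝ, 0 < ε → ∃ ν ∈ V, relDim ρ μ ν < (ε : EReal)

/-- The collection `M` of finite measures is relative dimension separable with respect to `ρ`. -/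
def RelDimSeparable {X : Type*} [MeasurableSpace X] (ρ : X → X → ℝ) (M : Set (Measure X)) :
    Prop :=
  ∃ V : Set (Measure X), WitnessesRelDimSeparability ρ M V

/-! ### The symbolic space `ℕ → A`; finite words are lists -/

/-- The left shift. -/
def shift {A : Type*} (ω : ℕ → A) : ℕ → A := fun n => ω (n + 1)

/-- The finite block `ω_j, …, ω_{j+k-1}` of a sequence. -/
def block {A : Type*} (ω : ℕ → A) (j k : ℕ) : List A := List.ofFn (fun i : Fin k => ω (j + i))

/-- The prefix `ω|_n` of length `n`. -/
def pre {A : Type*} (ω : ℕ → A) (n : ℕ) : List A := block ω 0 n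

/-- The longest common prefix `ω ∧ τ` of two different sequences
(`PiNat.firstDiff ω τ` is the least `n` with `ω n ≠ τ n`). -/
noncomputable def commonPrefix {A : Type*} (ω τ : ℕ → A) : List A := pre ω (PiNat.firstDiff ω τ)

/-- The cylinder `[w]` of all sequences that start with the word `w`. -/
def cylinder {A : Type*} (w : List A) : Set (ℕ → A) := {ω | pre ω w.length = w}

/-- The ergodic shift-invariant probability measures. -/
def ergodicMeasures (A : Type*) [MeasurableSpace A] : Set (Measure (ℕ → A)) :=
  {μ | IsProbabilityMeasure μ ∧ Ergodic (shift : (ℕ → A) → (ℕ → A)) μ}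

/-- The transition kernel `P_ν(a | w) = ν([wa]) / ν([w])`; it is `0` if `ν([w]) = 0`
(division by zero gives zero). -/
noncomputable def transition {A : Type*} [MeasurableSpace A] (ν : Measure (ℕ → A))
    (w : List A) (a : A) : ℝ :=
  ν.real (cylinder (w ++ [a])) / ν.real (cylinder w)

/-- `ν` is a `k`-step Markov measure: a shift-invariant probability measure with
`ν([ω_0 … ω_{k+m-1}]) = ν([ω_0 … ω_{k-1}]) ∏_{j<m} P_ν(ω_{j+k} | ω_j, …, ω_{j+k-1})`. -/
structure IsMarkov {A : Type*} [MeasurableSpace A] (k : ℕ) (ν : Measure (ℕ → A)) : Prop where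
  prob : IsProbabilityMeasure ν
  invariant : MeasurePreserving (shift : (ℕ → A) → (ℕ → A)) ν ν
  markov : ∀ (m : ℕ) (ω : ℕ → A), ν.real (cylinder (pre ω (k + m))) =
    ν.real (cylinder (pre ω k)) * ∏ j ∈ Finset.range m, transition ν (block ω j k) (ω (j + k))

/-- The ergodic measures that are `k`-step Markov for some `k ≥ 1` with all transition
probabilities rational. -/
def rationalMarkovMeasures (A : Type*) [MeasurableSpace A] : Set (Measure (ℕ → A)) :=
  {ν | ν ∈ ergodicMeasures A ∧ ∃ k : ℕ, 1 ≤ k ∧ IsMarkov k ν ∧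
    ∀ w : List A, w.length = k → ∀ a : A, ∃ q : ℚ, transition ν w a = (q : ℝ)}

/-- `ρ(ω, τ) = ψ(ω ∧ τ)` for `ω ≠ τ`, where `ψ > 0` decreases geometrically along prefixes. -/
def IsGeometricPrefixForm {A : Type*} (ρ : (ℕ → A) → (ℕ → A) → ℝ) : Prop :=
  ∃ ψ : List A → ℝ, (∀ w, 0 < ψ w) ∧
    (∀ ω τ : ℕ → A, ω ≠ τ → ρ ω τ = ψ (commonPrefix ω τ)) ∧
    ∃ γ : ℝ, 0 < γ ∧ γ < 1 ∧
      ∀ n : ℕ, 1 ≤ n → ∀ ω : ℕ → A, ψ (pre ω (n + 1)) ≤ γ * ψ (pre ω n)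

/-! ### Conformal iterated function systems -/

/-- `f` is a conformal `C^{1+θ}` self-map of `V`. The total function `f` is meaningful on an open
connected set `W ⊇ V` only, where it is a `C¹` diffeomorphism onto its image in `W` (injective,
with invertible differentials). On `V` the differentials are similitudes and depend Hölder
continuously on the point. -/
structure IsConformalMap {n : ℕ} (V : Set (EuclideanSpace ℝ (Fin n)))
    (f : EuclideanSpace ℝ (Fin n) → EuclideanSpace ℝ (Fin n)) : Prop where
  mapsTo : MapsTo f V V
  diffeo : ∃ W : Set (EuclideanSpace ℝ (Fin n)), IsOpen W ∧ IsConnected W ∧ V ⊆ W ∧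
    MapsTo f W W ∧ InjOn f W ∧ ContDiffOn ℝ 1 f W ∧
    ∀ x ∈ W, Function.Bijective (fderiv ℝ f x)
  similitude : ∀ x ∈ V, ∃ c : ℝ, 0 < c ∧ ∀ v, ‖fderiv ℝ f x v‖ = c * ‖v‖
  holder : ∃ C θ : NNReal, 0 < θ ∧ HolderOnWith C θ (fderiv ℝ f) V

/-- `(f_a)_{a ∈ A}` is a conformal `C^{1+θ}` iterated function system on `V`. -/
structure IsConformalIFS {n : ℕ} {A : Type*} (V : Set (EuclideanSpace ℝ (Fin n)))
    (f : A → EuclideanSpace ℝ (Fin n) → EuclideanSpace ℝ (Fin n)) : Prop where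
  compact : IsCompact V
  connected : IsConnected V
  regular : V = closure (interior V)
  conformal : ∀ a, IsConformalMap V (f a)
  contracting : ∀ a, ∀ x ∈ V, 0 < ‖fderiv ℝ (f a) x‖ ∧ ‖fderiv ℝ (f a) x‖ < 1

/-- The composition `f_w = f_{w_1} ∘ ⋯ ∘ f_{w_k}` along a finite word. -/
def wordMap {E A : Type*} (f : A → E → E) : List A → E → E
  | [] => id
  | a :: w => f a ∘ wordMap f w

/-- The supremum norm `‖f'_w‖` over `V` of the differential of `f_w`. -/
noncomputable def derivNorm {n : ℕ} {A : Type*} (V : Set (EuclideanSpace ℝ (Fin n)))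
    (f : A → EuclideanSpace ℝ (Fin n) → EuclideanSpace ℝ (Fin n)) (w : List A) : ℝ :=
  ⨆ x : V, ‖fderiv ℝ (wordMap f w) (x : EuclideanSpace ℝ (Fin n))‖

open Classical in
/-- The metric `ρ_F(ω, τ) = ‖f'_{ω ∧ τ}‖` (for `ω ≠ τ`) of a conformal iterated function system. -/
noncomputable def ifsMetric {n : ℕ} {A : Type*} (V : Set (EuclideanSpace ℝ (Fin n)))
    (f : A → EuclideanSpace ℝ (Fin n) → EuclideanSpace ℝ (Fin n)) (ω τ : ℕ → A) : ℝ :=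
  if ω = τ then 0 else derivNorm V f (commonPrefix ω τ)

end RelativeDimension

open RelativeDimension

/-! For a metric with geometric decay, a small ball around `ω` is a cylinder `[ω|_n]` whose length
`n` is at most a constant times `|log r|`. So `relDim ρ μ ν` is small as soon as `|log (μ[ω|_n] /
ν[ω|_n])| ≤ δ n` eventually for `μ`-almost every `ω` (`exists_relDim_lt`), and the metric plays no
further role.

One side of this comparison holds for every probability measure `ν`: the integral of `ν[ω|_n] /
μ[ω|_n]` against `μ` is at most 1, so the quotient is almost surely subexponential
(`ae_eventually_cylinder_le_exp_mul`).

The other side needs a Markov `ν` adapted to `μ`. Let `g` be the conditional probability of `ω_0`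
given the whole future (`pastDensity`) and `q` the same given only the next `k` letters
(`pastQuotient`). The integral of `μ[ω|_n] / ∏ g(σ^j ω)` is again at most 1, so `μ[ω|_n] ≤ e^{δn} ∏
g(σ^j ω)`. Martingale convergence in `L¹` and the ergodic theorem replace `g` by `q` for large `k`
(`exists_ae_eventually_cylinder_le`). Up to bounded factors `∏ q(σ^j ω)` telescopes into the product
of the forward `k`-step transition probabilities of `μ`. These are perturbed to rational ones with
the same support; the resulting chain inherits irreducibility from the ergodicity of `μ`, hence has
an ergodic stationary law (`exists_stationary_markov`, `HasMarkovProduct.ergodic`).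

The witness is countable because an ergodic Markov measure is determined by its transition table:
equal tables give absolute continuity, and ergodic measures related in this way are equal. For a
conformal system the chain rule makes `derivNorm` submultiplicative, and compactness makes it less
than 1 on letters. -/

namespace RelativeDimension

/-! ### Words, cylinders and measures on the sequence space. -/

variable {A : Type*}

lemma shift_iterate_apply (ω : ℕ → A) (j i : ℕ) : shift^[j] ω i = ω (i + j) := by
  induction j generalizing i with
  | zero => rfl
  | succ j ih => rw [Function.iterate_succ_apply', shift, ih]; congr 1; omega

lemma block_eq_pre (ω : ℕ → A) (j k : ℕ) : block ω j k = pre (shift^[j] ω) k := by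
  simp only [pre, block, shift_iterate_apply]
  congr 1; ext i; congr 1; omega

lemma pre_eq_pre_iff {ω τ : ℕ → A} {n : ℕ} : pre ω n = pre τ n ↔ ∀ i < n, ω i = τ i := by
  simp only [pre, block, List.ofFn_inj, funext_iff, Fin.forall_iff, zero_add]

@[simp] lemma length_pre (ω : ℕ → A) (n : ℕ) : (pre ω n).length = n := by simp [pre, block]

lemma pre_succ (ω : ℕ → A) (n : ℕ) : pre ω (n + 1) = pre ω n ++ [ω n] := by
  rw [pre, block, List.ofFn_succ_last]; simp [pre, block]

lemma cylinder_pre (ω : ℕ → A) (n : ℕ) : cylinder (pre ω n) = PiNat.cylinder ω n := by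
  ext τ
  simp [cylinder, pre_eq_pre_iff, PiNat.mem_cylinder_iff]

lemma shift_mem_cylinder_of_mem {ω τ : ℕ → A} {j n : ℕ} (h : τ ∈ PiNat.cylinder ω (j + n)) :
    shift^[j] τ ∈ PiNat.cylinder (shift^[j] ω) n := by
  intro i hi
  simp only [shift_iterate_apply]
  exact h _ (by omega)

lemma exists_pre_eq [Nonempty A] (w : List A) : ∃ ω : ℕ → A, pre ω w.length = w := by
  refine ⟨fun i => if h : i < w.length then w[i] else Classical.arbitrary A, ?_⟩
  apply List.ext_getElem <;> simp +contextual [pre, block]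

/-- The sequence that starts with `a` and continues with `ω`. -/
def prepend (a : A) (ω : ℕ → A) : ℕ → A
  | 0 => a
  | n + 1 => ω n

@[simp] lemma prepend_zero (a : A) (ω : ℕ → A) : prepend a ω 0 = a := rfl
@[simp] lemma prepend_succ (a : A) (ω : ℕ → A) (n : ℕ) : prepend a ω (n + 1) = ω n := rfl
@[simp] lemma shift_prepend (a : A) (ω : ℕ → A) : shift (prepend a ω) = ω := rfl
lemma prepend_shift (ω : ℕ → A) : prepend (ω 0) (shift ω) = ω := by
  ext n; cases n <;> rfl

lemma mem_cylinder_succ_iff {ω τ : ℕ → A} {n : ℕ} :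
    τ ∈ PiNat.cylinder ω (n + 1) ↔ τ 0 = ω 0 ∧ shift τ ∈ PiNat.cylinder (shift ω) n := by
  simp only [PiNat.mem_cylinder_iff, shift]
  constructor
  · exact fun h => ⟨h 0 (by omega), fun i hi => h _ (by omega)⟩
  · rintro ⟨h0, h⟩ (_ | i) hi
    · exact h0
    · exact h i (by omega)

/-- The cylinder of a word that is given as a function on `Fin n`. -/
def wordCylinder {n : ℕ} (s : Fin n → A) : Set (ℕ → A) := {ω | ∀ i : Fin n, ω i = s i}

/-- The word `ω_0 … ω_{n-1}` as a function on `Fin n`. -/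
def firstWord (n : ℕ) (ω : ℕ → A) : Fin n → A := fun i => ω i

lemma cylinder_eq_wordCylinder (ω : ℕ → A) (n : ℕ) :
    PiNat.cylinder ω n = wordCylinder (firstWord n ω) := by
  ext τ; simp [wordCylinder, firstWord, Fin.forall_iff, PiNat.mem_cylinder_iff]

lemma wordCylinder_eq_preimage {n : ℕ} (s : Fin n → A) : wordCylinder s = firstWord n ⁻¹' {s} := by
  ext τ; simp [wordCylinder, firstWord, funext_iff]

lemma exists_firstWord_eq [Nonempty A] {n : ℕ} (s : Fin n → A) : ∃ ω, firstWord n ω = s :=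
  ⟨fun i => if h : i < n then s ⟨i, h⟩ else Classical.arbitrary A, by ext i; simp [firstWord]⟩

lemma isPiSystem_cylinder (k : ℕ) :
    IsPiSystem {s : Set (ℕ → A) | ∃ ω n, k ≤ n ∧ s = PiNat.cylinder ω n} := by
  rintro _ ⟨ω, n, hn, rfl⟩ _ ⟨τ, m, hm, rfl⟩ ⟨x, hx, hx'⟩
  rw [← PiNat.mem_cylinder_iff_eq.1 hx, ← PiNat.mem_cylinder_iff_eq.1 hx']
  refine ⟨x, max n m, by omega, ?_⟩
  ext y
  simp only [mem_inter_iff, PiNat.mem_cylinder_iff]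
  constructor
  · rintro ⟨h1, h2⟩ i hi
    rcases lt_max_iff.1 hi with h | h
    · exact h1 i h
    · exact h2 i h
  · exact fun h => ⟨fun i hi => h i (by omega), fun i hi => h i (by omega)⟩

section Measure

variable [MeasurableSpace A]

@[fun_prop] lemma measurable_shift : Measurable (shift : (ℕ → A) → ℕ → A) :=
  measurable_pi_lambda _ fun n => measurable_pi_apply (n + 1)

@[fun_prop] lemma measurable_prepend (a : A) : Measurable (prepend a) :=
  measurable_pi_lambda _ fun n => by
    cases n with
    | zero => exact measurable_const
    | succ n => exact measurable_pi_apply n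

@[fun_prop] lemma measurable_firstWord (n : ℕ) :
    Measurable (firstWord n : (ℕ → A) → Fin n → A) :=
  measurable_pi_lambda _ fun _ => measurable_pi_apply _

lemma transition_block (ν : Measure (ℕ → A)) (ω : ℕ → A) (j k : ℕ) :
    transition ν (block ω j k) (ω (j + k)) = ν.real (PiNat.cylinder (shift^[j] ω) (k + 1)) /
      ν.real (PiNat.cylinder (shift^[j] ω) k) := by
  have : ω (j + k) = shift^[j] ω k := by rw [shift_iterate_apply, add_comm]
  rw [transition, block_eq_pre, this, ← pre_succ, cylinder_pre, cylinder_pre]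

variable [Finite A] [DiscreteMeasurableSpace A]

lemma measurableSet_wordCylinder {n : ℕ} (s : Fin n → A) : MeasurableSet (wordCylinder s) := by
  rw [wordCylinder_eq_preimage]
  exact measurable_firstWord n (MeasurableSet.of_discrete)

lemma measurableSet_cylinder (ω : ℕ → A) (n : ℕ) : MeasurableSet (PiNat.cylinder ω n) := by
  rw [cylinder_eq_wordCylinder]; exact measurableSet_wordCylinder _

lemma measurable_cylinder_fun {β : Type*} [MeasurableSpace β] (n : ℕ)
    (F : (Fin n → A) → β) : Measurable fun ω : ℕ → A => F (firstWord n ω) :=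
  (measurable_of_finite F).comp (measurable_firstWord n)

lemma measurable_measure_cylinder (μ : Measure (ℕ → A)) (n : ℕ) :
    Measurable fun ω : ℕ → A => μ (PiNat.cylinder ω n) := by
  simp only [cylinder_eq_wordCylinder]
  exact measurable_cylinder_fun n fun s => μ (wordCylinder s)

lemma sum_measure_wordCylinder [Fintype A] (μ : Measure (ℕ → A)) (n : ℕ) :
    ∑ s : Fin n → A, μ (wordCylinder s) = μ univ := by
  simp only [wordCylinder_eq_preimage]
  rw [sum_measure_preimage_singleton]
  · simp
  · exact fun s _ => measurable_firstWord n (MeasurableSet.of_discrete)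

lemma generateFrom_cylinder (k : ℕ) : (inferInstance : MeasurableSpace (ℕ → A)) =
    MeasurableSpace.generateFrom {s | ∃ ω n, k ≤ n ∧ s = PiNat.cylinder ω n} := by
  apply le_antisymm
  · refine iSup_le fun i => ?_
    rintro _ ⟨t, -, rfl⟩
    -- The coordinate `i` is read off from words of length `k + i + 1`. Empty cylinders are
    -- discarded since each generator is indexed by a sequence that it contains.
    have : (fun b : ℕ → A => b i) ⁻¹' t = ⋃ s ∈ {s : Fin (k + i + 1) → A |
        s ⟨i, by omega⟩ ∈ t ∧ (wordCylinder s).Nonempty}, wordCylinder s := by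
      ext ω
      simp only [mem_preimage, mem_ofPred_eq, mem_iUnion, exists_prop]
      constructor
      · exact fun h => ⟨firstWord _ ω, ⟨h, ω, fun _ => rfl⟩, fun _ => rfl⟩
      · rintro ⟨s, ⟨h, -⟩, h'⟩
        rwa [h' ⟨i, by omega⟩]
    rw [this]
    refine MeasurableSet.biUnion (to_countable _) fun s hs => ?_
    obtain ⟨ω, hω⟩ := hs.2
    refine MeasurableSpace.measurableSet_generateFrom ⟨ω, k + i + 1, by omega, ?_⟩
    rw [cylinder_eq_wordCylinder]
    congr 1; ext i; exact (hω i).symm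
  · refine MeasurableSpace.generateFrom_le ?_
    rintro _ ⟨ω, n, -, rfl⟩
    exact measurableSet_cylinder ω n

/-- Short cylinders are not needed, which suits chains of order `k`: their product formula starts at
length `k`. The total masses agree by summing over words of length `k`. -/
lemma ext_of_cylinder {μ ν : Measure (ℕ → A)} [IsFiniteMeasure μ] (k : ℕ)
    (h : ∀ ω n, k ≤ n → μ (PiNat.cylinder ω n) = ν (PiNat.cylinder ω n)) : μ = ν := by
  cases nonempty_fintype A
  refine ext_of_generate_finite _ (generateFrom_cylinder k) (isPiSystem_cylinder k) ?_ ?_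
  · rintro _ ⟨ω, n, hn, rfl⟩
    exact h ω n hn
  · rw [← sum_measure_wordCylinder μ k, ← sum_measure_wordCylinder ν k]
    refine Finset.sum_congr rfl fun s _ => ?_
    rcases (wordCylinder s).eq_empty_or_nonempty with hs | ⟨ω, hω⟩
    · simp [hs]
    · have : s = firstWord k ω := funext fun i => (hω i).symm
      rw [this, ← cylinder_eq_wordCylinder]
      exact h ω k le_rfl

lemma measure_cylinder_eq_sum [Fintype A] (μ : Measure (ℕ → A)) (ω : ℕ → A) (n : ℕ) :
    μ (PiNat.cylinder ω n) = ∑ a, μ (PiNat.cylinder ω n ∩ {τ | τ n = a}) := by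
  have h := sum_measure_preimage_singleton (μ := μ.restrict (PiNat.cylinder ω n))
    (f := fun τ : ℕ → A => τ n) Finset.univ
    fun a _ => measurable_pi_apply n (MeasurableSet.of_discrete)
  simp only [Finset.coe_univ, preimage_univ, Measure.restrict_apply_univ] at h
  rw [← h]
  refine Finset.sum_congr rfl fun a _ => ?_
  rw [Measure.restrict_apply (measurable_pi_apply n (MeasurableSet.of_discrete)), inter_comm]
  rfl

/-- There are finitely many words of each length, so the null cylinders have a null union. -/
lemma ae_measure_cylinder_pos (μ : Measure (ℕ → A)) :
    ∀ᵐ ω ∂μ, ∀ n, 0 < μ (PiNat.cylinder ω n) := by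
  rw [ae_all_iff]
  intro n
  have : {ω | ¬ 0 < μ (PiNat.cylinder ω n)} ⊆
      ⋃ s ∈ {s : Fin n → A | μ (wordCylinder s) = 0}, wordCylinder s := by
    intro ω hω
    simp only [mem_ofPred_eq, not_lt, nonpos_iff_eq_zero, cylinder_eq_wordCylinder] at hω
    exact mem_biUnion (show firstWord n ω ∈ {s : Fin n → A | μ (wordCylinder s) = 0} from hω)
      fun _ => rfl
  exact measure_mono_null this ((measure_biUnion_null_iff (to_countable _)).2 fun s hs => hs)

lemma ae_measure_cylinder_iterate_pos {μ : Measure (ℕ → A)}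
    (hμ : MeasurePreserving shift μ μ) :
    ∀ᵐ ω ∂μ, ∀ j n, 0 < μ (PiNat.cylinder (shift^[j] ω) n) :=
  ae_all_iff.2 fun j => (hμ.iterate j).quasiMeasurePreserving.ae (ae_measure_cylinder_pos μ)

end Measure

end RelativeDimension

/-! ### Prefix metrics and conformal iterated function systems. -/

namespace RelativeDimension

variable {A : Type*}

lemma commonPrefix_comm (ω τ : ℕ → A) : commonPrefix ω τ = commonPrefix τ ω := by
  rw [commonPrefix, commonPrefix, PiNat.firstDiff_comm τ ω, pre_eq_pre_iff]
  exact fun i hi => PiNat.apply_eq_of_lt_firstDiff hi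

open Classical in
/-- A positive function on words that does not increase along prefixes defines a metric. -/
lemma isMetric_of_antitone (ψ : List A → ℝ) (hpos : ∀ (ω : ℕ → A) n, 0 < ψ (pre ω n))
    (hanti : ∀ (ω : ℕ → A) n, ψ (pre ω (n + 1)) ≤ ψ (pre ω n)) :
    IsMetric fun ω τ : ℕ → A => if ω = τ then 0 else ψ (commonPrefix ω τ) where
  eq_zero_iff ω τ := by
    by_cases h : ω = τ
    · simp [h]
    · simp [h, commonPrefix, (hpos _ _).ne']
  symm ω τ := by simp only [eq_comm (a := ω), commonPrefix_comm ω]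
  triangle x y z := by
    have hanti' : ∀ ω : ℕ → A, Antitone fun n => ψ (pre ω n) := fun ω =>
      antitone_nat_of_succ_le (hanti ω)
    by_cases hxz : x = z
    · subst hxz
      by_cases hxy : x = y
      · simp [hxy]
      · simp only [hxy, Ne.symm hxy, if_true, if_false]
        exact add_nonneg (hpos _ _).le (hpos _ _).le
    by_cases hxy : x = y
    · simp [hxy]
    by_cases hyz : y = z
    · simp [hyz]
    simp only [hxz, hxy, hyz, if_false]
    -- The prefix shared by `x` and `z` is at least as long as one of the other two. Prefixes of `x`
    -- are compared in the first case; in the second, symmetry rewrites both words as prefixes of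
    -- `z`.
    rcases min_le_iff.1 (PiNat.min_firstDiff_le x y z hxz) with h | h
    · exact (hanti' x h).trans (le_add_of_nonneg_right (hpos _ _).le)
    · refine le_trans ?_ (le_add_of_nonneg_left (hpos _ _).le)
      rw [commonPrefix_comm x z, commonPrefix_comm y z, commonPrefix, commonPrefix,
        PiNat.firstDiff_comm z x, PiNat.firstDiff_comm z y]
      exact hanti' z h

section IFS

variable {n : ℕ} {V : Set (EuclideanSpace ℝ (Fin n))}
  {f : A → EuclideanSpace ℝ (Fin n) → EuclideanSpace ℝ (Fin n)}

lemma IsConformalMap.differentiableAt {g : EuclideanSpace ℝ (Fin n) → EuclideanSpace ℝ (Fin n)}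
    (hg : IsConformalMap V g) {x} (hx : x ∈ V) : DifferentiableAt ℝ g x := by
  obtain ⟨W, hW, -, hVW, -, -, h, -⟩ := hg.diffeo
  exact (h.differentiableOn one_ne_zero).differentiableAt (hW.mem_nhds (hVW hx))

lemma IsConformalMap.continuousOn_fderiv
    {g : EuclideanSpace ℝ (Fin n) → EuclideanSpace ℝ (Fin n)}
    (hg : IsConformalMap V g) : ContinuousOn (fderiv ℝ g) V := by
  obtain ⟨C, θ, hθ, h⟩ := hg.holder
  exact h.continuousOn hθ

lemma wordMap_append {E : Type*} (f : A → E → E) (u v : List A) :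
    wordMap f (u ++ v) = wordMap f u ∘ wordMap f v := by
  induction u with
  | nil => rfl
  | cons a u ih => simp only [List.cons_append, wordMap, ih]; rfl

lemma IsConformalIFS.mapsTo_wordMap (hf : IsConformalIFS V f) (w : List A) :
    MapsTo (wordMap f w) V V := by
  induction w with
  | nil => exact mapsTo_id V
  | cons a w ih => exact (hf.conformal a).mapsTo.comp ih

lemma IsConformalIFS.differentiableAt_wordMap (hf : IsConformalIFS V f) (w : List A) {x}
    (hx : x ∈ V) : DifferentiableAt ℝ (wordMap f w) x := by
  induction w with
  | nil => exact differentiableAt_id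
  | cons a w ih =>
    exact ((hf.conformal a).differentiableAt (hf.mapsTo_wordMap w hx)).comp x ih

lemma IsConformalIFS.fderiv_wordMap_append (hf : IsConformalIFS V f) (u v : List A) {x}
    (hx : x ∈ V) : fderiv ℝ (wordMap f (u ++ v)) x =
      (fderiv ℝ (wordMap f u) (wordMap f v x)).comp (fderiv ℝ (wordMap f v) x) := by
  rw [wordMap_append]
  exact fderiv_comp x (hf.differentiableAt_wordMap u (hf.mapsTo_wordMap v hx))
    (hf.differentiableAt_wordMap v hx)

lemma IsConformalIFS.injective_fderiv_wordMap (hf : IsConformalIFS V f) (w : List A) {x}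
    (hx : x ∈ V) : Function.Injective (fderiv ℝ (wordMap f w) x) := by
  induction w with
  | nil => simp [wordMap, Function.injective_id]
  | cons a w ih =>
    have := hf.fderiv_wordMap_append [a] w hx
    simp only [List.cons_append, List.nil_append] at this
    rw [this, ContinuousLinearMap.coe_comp]
    refine Function.Injective.comp ?_ ih
    obtain ⟨W, -, -, hVW, -, -, -, h⟩ := (hf.conformal a).diffeo
    exact (h _ (hVW (hf.mapsTo_wordMap w hx))).1

lemma IsConformalIFS.continuousOn_fderiv_wordMap (hf : IsConformalIFS V f) (w : List A) :
    ContinuousOn (fderiv ℝ (wordMap f w)) V := by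
  induction w with
  | nil =>
    have : fderiv ℝ (wordMap f []) = fun _ => ContinuousLinearMap.id ℝ _ :=
      funext fun x => fderiv_id
    rw [this]
    exact continuousOn_const
  | cons a w ih =>
    have h : ∀ x ∈ V, fderiv ℝ (wordMap f (a :: w)) x =
        (fderiv ℝ (f a) (wordMap f w x)).comp (fderiv ℝ (wordMap f w) x) :=
      fun x hx => hf.fderiv_wordMap_append [a] w hx
    refine ContinuousOn.congr ?_ h
    refine ContinuousOn.clm_comp ?_ ih
    exact (hf.conformal a).continuousOn_fderiv.comp
      (fun x hx => (hf.differentiableAt_wordMap w hx).continuousAt.continuousWithinAt)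
      (hf.mapsTo_wordMap w)

lemma IsConformalIFS.bddAbove_fderiv_wordMap (hf : IsConformalIFS V f) (w : List A) :
    BddAbove (range fun x : V => ‖fderiv ℝ (wordMap f w) (x : EuclideanSpace ℝ (Fin n))‖) := by
  have := (hf.compact.image_of_continuousOn
    (hf.continuousOn_fderiv_wordMap w).norm).bddAbove
  rwa [image_eq_range] at this

lemma IsConformalIFS.norm_fderiv_le_derivNorm (hf : IsConformalIFS V f) (w : List A) {x}
    (hx : x ∈ V) : ‖fderiv ℝ (wordMap f w) x‖ ≤ derivNorm V f w :=
  le_ciSup (hf.bddAbove_fderiv_wordMap w) ⟨x, hx⟩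

lemma IsConformalIFS.derivNorm_pos (hf : IsConformalIFS V f) [Nonempty A] (w : List A) :
    0 < derivNorm V f w := by
  obtain ⟨x, hx⟩ := hf.connected.nonempty
  refine lt_of_lt_of_le ?_ (hf.norm_fderiv_le_derivNorm w hx)
  rw [norm_pos_iff]
  intro h0
  have hinj := hf.injective_fderiv_wordMap w hx
  rw [h0] at hinj
  -- An injective differential can vanish only in dimension zero, which is excluded once some map of
  -- the system has a nonzero differential.
  have hne := (hf.contracting (Classical.arbitrary A) x hx).1
  rw [norm_pos_iff] at hne
  apply hne
  ext1 v
  have : v = 0 := hinj (by simp)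
  simp [this]

/-- Chain rule; the supremum for `u` may be used because `wordMap f v` maps `V` into itself. -/
lemma IsConformalIFS.derivNorm_append_le (hf : IsConformalIFS V f) (u v : List A) :
    derivNorm V f (u ++ v) ≤ derivNorm V f v * derivNorm V f u := by
  have := hf.connected.nonempty.to_subtype
  refine ciSup_le fun x => ?_
  rw [hf.fderiv_wordMap_append u v x.2, mul_comm]
  refine (ContinuousLinearMap.opNorm_comp_le _ _).trans ?_
  have h1 := hf.norm_fderiv_le_derivNorm u (hf.mapsTo_wordMap v x.2)
  have h2 := hf.norm_fderiv_le_derivNorm v x.2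
  exact mul_le_mul h1 h2 (norm_nonneg _) ((norm_nonneg _).trans h1)

/-- The inequality stays strict for the supremum because it is attained on the compact set `V`. -/
lemma IsConformalIFS.derivNorm_singleton_lt_one (hf : IsConformalIFS V f) (a : A) :
    derivNorm V f [a] < 1 := by
  obtain ⟨x, hx, hmax⟩ := hf.compact.exists_isMaxOn hf.connected.nonempty
    (hf.continuousOn_fderiv_wordMap [a]).norm
  have := hf.connected.nonempty.to_subtype
  refine lt_of_le_of_lt (ciSup_le fun y => hmax y.2) ?_
  exact (hf.contracting a x hx).2

lemma IsConformalIFS.exists_contraction [Finite A] [Nonempty A] (hf : IsConformalIFS V f) :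
    ∃ γ : ℝ, 0 < γ ∧ γ < 1 ∧
      ∀ (ω : ℕ → A) m, derivNorm V f (pre ω (m + 1)) ≤ γ * derivNorm V f (pre ω m) := by
  obtain ⟨a, ha⟩ := Finite.exists_max fun a : A => derivNorm V f [a]
  refine ⟨derivNorm V f [a], hf.derivNorm_pos _, hf.derivNorm_singleton_lt_one a, fun ω m => ?_⟩
  rw [pre_succ]
  exact (hf.derivNorm_append_le _ _).trans
    (mul_le_mul_of_nonneg_right (ha _) (hf.derivNorm_pos _).le)

lemma IsConformalIFS.isMetric_ifsMetric [Finite A] (hf : IsConformalIFS V f) :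
    IsMetric (ifsMetric V f) := by
  refine isMetric_of_antitone (derivNorm V f) (fun ω m => ?_) fun ω m => ?_
  · have : Nonempty A := ⟨ω 0⟩
    exact hf.derivNorm_pos _
  · have : Nonempty A := ⟨ω 0⟩
    obtain ⟨γ, -, h1, h⟩ := hf.exists_contraction
    exact (h ω m).trans (mul_le_of_le_one_left (hf.derivNorm_pos _).le h1.le)

lemma IsConformalIFS.isGeometricPrefixForm_ifsMetric [Finite A] (hf : IsConformalIFS V f) :
    IsGeometricPrefixForm (ifsMetric V f) := by
  rcases isEmpty_or_nonempty A with hA | hA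
  -- Without letters there are no sequences, and any positive `ψ` will do.
  · exact ⟨fun _ => 1, fun _ => one_pos, fun ω => (hA.false (ω 0)).elim, 1 / 2, by norm_num,
      by norm_num, fun _ _ ω => (hA.false (ω 0)).elim⟩
  · obtain ⟨γ, h0, h1, h⟩ := hf.exists_contraction
    exact ⟨derivNorm V f, hf.derivNorm_pos, fun ω τ hne => if_neg hne, γ, h0, h1,
      fun m _ ω => h ω m⟩

end IFS

end RelativeDimension

/-! ### From balls to cylinders: reduction of the relative dimension. -/

namespace RelativeDimension

variable {A : Type*}

/-- Small balls of a geometric prefix metric are cylinders, whose lengths are at most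
proportional to the logarithm of the radius. -/
lemma exists_ball_eq_cylinder {ρ : (ℕ → A) → (ℕ → A) → ℝ} (hρ : IsMetric ρ)
    (hform : IsGeometricPrefixForm ρ) :
    ∃ c : ℝ, 0 < c ∧ ∀ (ω : ℕ → A) (N : ℕ), ∀ᶠ r in 𝓝[>] (0 : ℝ),
      ∃ n, N ≤ n ∧ ball ρ ω r = PiNat.cylinder ω n ∧ Real.log r ≤ -(c * n) := by
  obtain ⟨ψ, hpos, hψ, γ, h0, h1, hγ⟩ := hform
  have hlog : Real.log γ < 0 := Real.log_neg h0 h1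
  -- Half of the decay rate; the other half absorbs `ψ (pre ω 1)` and the shift of the length by 2.
  -- Both are negligible for `n ≥ M`, with `M` chosen below.
  refine ⟨-Real.log γ / 2, by linarith, fun ω N => ?_⟩
  have hgeom : ∀ n, ψ (pre ω (n + 1)) ≤ γ ^ n * ψ (pre ω 1) := by
    intro n
    induction n with
    | zero => simp
    | succ n ih =>
      calc ψ (pre ω (n + 1 + 1)) ≤ γ * ψ (pre ω (n + 1)) := hγ _ (by omega) ω
        _ ≤ γ * (γ ^ n * ψ (pre ω 1)) := mul_le_mul_of_nonneg_left ih h0.le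
        _ = _ := by ring
  have hanti : ∀ m n, 1 ≤ m → m ≤ n → ψ (pre ω n) ≤ ψ (pre ω m) := by
    intro m n hm hmn
    induction n, hmn using Nat.le_induction with
    | base => exact le_rfl
    | succ n hn ih =>
      exact ((hγ n (by omega) ω).trans (mul_le_of_le_one_left (hpos _).le h1.le)).trans ih
  obtain ⟨M, hM⟩ := exists_nat_ge
    ((Real.log (ψ (pre ω 1)) - 2 * Real.log γ) / (-Real.log γ / 2))
  have hev : ∀ᶠ r in 𝓝[>] (0 : ℝ), ∀ i ∈ Finset.range (N + M + 2), r ≤ ψ (pre ω i) := by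
    rw [eventually_all_finset]
    intro i _
    exact nhdsWithin_le_nhds (eventually_le_nhds (hpos _))
  filter_upwards [hev, self_mem_nhdsWithin] with r hr hr0
  rw [mem_Ioi] at hr0
  have hex : ∃ n, ψ (pre ω n) < r := by
    obtain ⟨n, hn⟩ := exists_pow_lt_of_lt_one (div_pos hr0 (hpos (pre ω 1))) h1
    exact ⟨n + 1, (hgeom n).trans_lt ((lt_div_iff₀ (hpos _)).1 hn)⟩
  classical
  -- The ball is the cylinder at the first prefix with `ψ < r`. Minimality also covers the empty
  -- prefix, from which no decay is assumed.
  set n := Nat.find hex with hn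
  have hspec : ψ (pre ω n) < r := Nat.find_spec hex
  have hmin : ∀ m < n, r ≤ ψ (pre ω m) := fun m hm => not_lt.1 (Nat.find_min hex hm)
  have hlarge : N + M + 2 ≤ n := by
    by_contra h
    exact absurd hspec (not_lt.2 (hr n (Finset.mem_range.2 (by omega))))
  refine ⟨n, by omega, ?_, ?_⟩
  · ext τ
    by_cases hne : τ = ω
    · subst hne
      simp [ball, (hρ.eq_zero_iff τ τ).2 rfl, hr0]
    · rw [PiNat.mem_cylinder_iff_le_firstDiff hne, PiNat.firstDiff_comm]
      simp only [ball, mem_ofPred_eq, hψ ω τ (Ne.symm hne), commonPrefix]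
      constructor
      · intro h
        by_contra hlt
        exact absurd h (not_lt.2 (hmin _ (not_le.1 hlt)))
      · exact fun h => (hanti n _ (by omega) h).trans_lt hspec
  · obtain ⟨p, hp⟩ : ∃ p, n = p + 2 := ⟨n - 2, by omega⟩
    -- The prefix one letter shorter still has `ψ ≥ r`, which bounds `n` in terms of `log r`.
    have h2 : r ≤ γ ^ p * ψ (pre ω 1) := (hmin (p + 1) (by omega)).trans (hgeom p)
    have h3 := Real.log_le_log hr0 h2
    rw [Real.log_mul (pow_pos h0 p).ne' (hpos _).ne', Real.log_pow] at h3
    have h4 : (M : ℝ) ≤ n := by exact_mod_cast (by omega : M ≤ n)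
    have h5 := (div_le_iff₀ (by linarith : 0 < -Real.log γ / 2)).1 (hM.trans h4)
    have h6 : (n : ℝ) = p + 2 := by rw [hp]; push_cast; ring
    rw [h6] at h5 ⊢
    linarith

variable [MeasurableSpace A]

lemma relDim_lt_of_ae_eventually_logRatio {ρ : (ℕ → A) → (ℕ → A) → ℝ} {μ ν : Measure (ℕ → A)}
    [NeZero μ] {δ ε : ℝ} (hδ : 0 ≤ δ) (hδε : δ < ε)
    (h : ∀ᵐ ω ∂μ, ∀ᶠ r in 𝓝[>] (0 : ℝ),
      ((-δ : ℝ) : EReal) ≤ logRatio ρ μ ν ω r ∧ logRatio ρ μ ν ω r ≤ (δ : EReal)) :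
    relDim ρ μ ν < (ε : EReal) := by
  -- The bounds defining `relDim` are strict, and so is the conclusion, hence a level strictly
  -- between `δ` and `ε`.
  obtain ⟨η, h1, h2⟩ := exists_between hδε
  refine lt_of_le_of_lt (sInf_le ⟨η, ⟨hδ.trans_lt h1, ?_, ?_, ?_⟩, rfl⟩) (EReal.coe_lt_coe_iff.2 h2)
  · refine lt_of_lt_of_le ?_ (le_essInf_of_ae_le ((-δ : ℝ) : EReal) ?_)
    · rw [← EReal.coe_neg]
      exact EReal.coe_lt_coe_iff.2 (neg_lt_neg h1)
    · filter_upwards [h] with ω hω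
      exact le_liminf_of_le (by isBoundedDefault) (hω.mono fun r hr => hr.1)
  -- For the zero measure the essential infimum would be `⊤` and the essential supremum `⊥`.
  · have hne : (ae μ).NeBot := ae_neBot.2 (NeZero.ne μ)
    exact (liminf_le_limsup (by isBoundedDefault) (by isBoundedDefault)).trans
      (limsup_le_limsup (Eventually.of_forall fun ω =>
        liminf_le_limsup (by isBoundedDefault) (by isBoundedDefault))
        (by isBoundedDefault) (by isBoundedDefault))
  · refine lt_of_le_of_lt (essSup_le_of_ae_le (δ : EReal) ?_) (EReal.coe_lt_coe_iff.2 h1)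
    filter_upwards [h] with ω hω
    exact limsup_le_of_le (by isBoundedDefault) (hω.mono fun r hr => hr.2)

lemma logRatio_eq_coe {ρ : (ℕ → A) → (ℕ → A) → ℝ} {μ ν : Measure (ℕ → A)}
    [IsFiniteMeasure μ] [IsFiniteMeasure ν] {ω : ℕ → A} {r : ℝ}
    (hμ : 0 < μ.real (ball ρ ω r)) (hν : 0 < ν.real (ball ρ ω r)) :
    logRatio ρ μ ν ω r =
      ((Real.log (μ.real (ball ρ ω r) / ν.real (ball ρ ω r)) / Real.log r : ℝ) : EReal) := by
  have : μ (ball ρ ω r) / ν (ball ρ ω r) =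
      ENNReal.ofReal (μ.real (ball ρ ω r) / ν.real (ball ρ ω r)) := by
    rw [ENNReal.ofReal_div_of_pos hν, measureReal_def, measureReal_def,
      ENNReal.ofReal_toReal (measure_ne_top _ _), ENNReal.ofReal_toReal (measure_ne_top _ _)]
  rw [logRatio, this, ENNReal.log_ofReal_of_pos (div_pos hμ hν), EReal.coe_div]

/-- With `|log r| ≥ c n` on a ball equal to an `n`-cylinder, an error of `δ n` with `δ = c ε / 2`
contributes at most `ε / 2`. The value of `δ` does not depend on the measures. -/
lemma exists_relDim_lt {ρ : (ℕ → A) → (ℕ → A) → ℝ} (hρ : IsMetric ρ)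
    (hform : IsGeometricPrefixForm ρ) {ε : ℝ} (hε : 0 < ε) :
    ∃ δ : ℝ, 0 < δ ∧ ∀ (μ ν : Measure (ℕ → A)) [IsProbabilityMeasure μ] [IsFiniteMeasure ν],
      (∀ᵐ ω ∂μ, ∀ᶠ n in atTop, 0 < μ.real (PiNat.cylinder ω n) ∧
        0 < ν.real (PiNat.cylinder ω n) ∧
        |Real.log (μ.real (PiNat.cylinder ω n) / ν.real (PiNat.cylinder ω n))| ≤ δ * n) →
      relDim ρ μ ν < (ε : EReal) := by
  obtain ⟨c, hc, hball⟩ := exists_ball_eq_cylinder hρ hform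
  refine ⟨c * (ε / 2), by positivity, fun μ ν _ _ h => ?_⟩
  refine relDim_lt_of_ae_eventually_logRatio (half_pos hε).le (half_lt_self hε) ?_
  filter_upwards [h] with ω hω
  obtain ⟨N, hN⟩ := eventually_atTop.1 hω
  -- Using `N + 1` ensures `n > 0`, so that `log r` is strictly negative.
  filter_upwards [hball ω (N + 1)] with r ⟨n, hn, heq, hr⟩
  obtain ⟨hμ, hν, hle⟩ := hN n (by omega)
  rw [← heq] at hμ hν hle
  have hn0 : (0 : ℝ) < n := by exact_mod_cast (by omega : 0 < n)
  have hr' : Real.log r < 0 := hr.trans_lt (neg_lt_zero.2 (mul_pos hc hn0))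
  rw [logRatio_eq_coe hμ hν, EReal.coe_le_coe_iff, EReal.coe_le_coe_iff, ← abs_le, abs_div,
    abs_of_neg hr', div_le_iff₀ (neg_pos.2 hr')]
  refine hle.trans ?_
  nlinarith

end RelativeDimension

/-! ### Maximal inequality, upper ergodic theorem, almost sure subexponential growth. -/

namespace RelativeDimension

variable {Ω : Type*}

/-- The maximum of the Birkhoff sums of lengths `0, …, N`. -/
noncomputable def maxBirkhoffSum (T : Ω → Ω) (f : Ω → ℝ) : ℕ → Ω → ℝ
  | 0 => 0
  | N + 1 => fun x => max 0 (f x + maxBirkhoffSum T f N (T x))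

variable {T : Ω → Ω} {f : Ω → ℝ}

lemma maxBirkhoffSum_nonneg (N : ℕ) (x : Ω) : 0 ≤ maxBirkhoffSum T f N x := by
  cases N with
  | zero => exact le_rfl
  | succ N => exact le_max_left _ _

lemma maxBirkhoffSum_le_succ (N : ℕ) (x : Ω) :
    maxBirkhoffSum T f N x ≤ maxBirkhoffSum T f (N + 1) x := by
  induction N generalizing x with
  | zero => exact maxBirkhoffSum_nonneg 1 x
  | succ N ih => exact max_le_max le_rfl (add_le_add le_rfl (ih (T x)))

lemma birkhoffSum_le_maxBirkhoffSum (n : ℕ) (x : Ω) :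
    birkhoffSum T f n x ≤ maxBirkhoffSum T f n x := by
  induction n generalizing x with
  | zero => simp [maxBirkhoffSum]
  | succ n ih =>
    rw [birkhoffSum_succ']
    exact le_max_of_le_right (add_le_add le_rfl (ih (T x)))

variable [MeasurableSpace Ω] {μ : Measure Ω}

lemma integrable_maxBirkhoffSum (hT : MeasurePreserving T μ μ) (hf : Integrable f μ) (N : ℕ) :
    Integrable (maxBirkhoffSum T f N) μ := by
  induction N with
  | zero => exact integrable_zero _ _ _
  | succ N ih => exact (integrable_zero _ _ _).sup (hf.add (hT.integrable_comp_of_integrable ih))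

lemma measurable_maxBirkhoffSum (hT : Measurable T) (hf : Measurable f) (N : ℕ) :
    Measurable (maxBirkhoffSum T f N) := by
  induction N with
  | zero => exact measurable_const
  | succ N ih => exact measurable_const.max (hf.add (ih.comp hT))

/-- The maximal ergodic inequality. -/
lemma setIntegral_nonneg_of_maxBirkhoffSum_pos (hT : MeasurePreserving T μ μ)
    (hf : Integrable f μ) (hfm : Measurable f) (N : ℕ) :
    0 ≤ ∫ x in {x | 0 < maxBirkhoffSum T f N x}, f x ∂μ := by
  set F := maxBirkhoffSum T f N with hF
  have hFi : Integrable F μ := integrable_maxBirkhoffSum hT hf N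
  have hFT : Integrable (F ∘ T) μ := hT.integrable_comp_of_integrable hFi
  have hFm : Measurable F := measurable_maxBirkhoffSum hT.measurable hfm N
  have hE : MeasurableSet {x | 0 < F x} := measurableSet_lt measurable_const hFm
  -- Garsia's argument: `F ≤ max 0 (f + F ∘ T)`, and where `F > 0` the maximum is not 0.
  -- Integrating, invariance and `F ≥ 0` make the left side nonnegative.
  have key : ∀ x ∈ {x | 0 < F x}, F x - F (T x) ≤ f x := by
    intro x hx
    have h1 : F x ≤ max 0 (f x + F (T x)) := maxBirkhoffSum_le_succ N x
    rcases le_max_iff.1 h1 with h | h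
    · exact absurd hx (not_lt.2 h)
    · linarith
  have h1 : ∫ x in {x | 0 < F x}, F x ∂μ = ∫ x, F x ∂μ := by
    rw [← integral_indicator hE]
    congr 1; ext x
    by_cases hx : 0 < F x
    · rw [indicator_of_mem (show x ∈ {x | 0 < F x} from hx)]
    · rw [indicator_of_notMem (show x ∉ {x | 0 < F x} from hx)]
      exact le_antisymm (maxBirkhoffSum_nonneg N x) (not_lt.1 hx)
  have h2 : ∫ x in {x | 0 < F x}, F (T x) ∂μ ≤ ∫ x, F x ∂μ := by
    refine (setIntegral_le_integral hFT
      (Eventually.of_forall fun x => maxBirkhoffSum_nonneg N (T x))).trans ?_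
    have := integral_map hT.aemeasurable (f := F)
      (hFm.aestronglyMeasurable)
    rw [hT.map_eq] at this
    exact this.symm.le
  have h3 : ∫ x in {x | 0 < F x}, (F x - F (T x)) ∂μ ≤ ∫ x in {x | 0 < F x}, f x ∂μ :=
    setIntegral_mono_on (hFi.sub hFT).integrableOn hf.integrableOn hE key
  have h4 : ∫ x in {x | 0 < F x}, (F x - F (T x)) ∂μ =
      ∫ x in {x | 0 < F x}, F x ∂μ - ∫ x in {x | 0 < F x}, F (T x) ∂μ :=
    integral_sub hFi.integrableOn hFT.integrableOn
  linarith

/-- If `f` is integrable with negative integral then, for an ergodic map, almost every orbit has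
Birkhoff sums bounded above. -/
lemma ae_bddAbove_birkhoffSum [IsProbabilityMeasure μ] (hT : Ergodic T μ) (hf : Integrable f μ)
    (hfm : Measurable f) (hneg : ∫ x, f x ∂μ < 0) :
    ∀ᵐ x ∂μ, ∃ C : ℝ, ∀ n, birkhoffSum T f n x ≤ C := by
  -- Integer bounds make `G` a countable union of measurable sets. It is invariant, so ergodicity
  -- leaves only the null case to exclude.
  set G : Set Ω := {x | ∃ C : ℕ, ∀ n, birkhoffSum T f n x ≤ C} with hG
  have hbm : ∀ n, Measurable (birkhoffSum T f n) := fun n =>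
    Finset.measurable_sum _ fun i _ => hfm.comp (hT.measurable.iterate i)
  have hGm : MeasurableSet G := by
    have : G = ⋃ C : ℕ, ⋂ n, {x | birkhoffSum T f n x ≤ C} := by ext; simp [hG]
    rw [this]
    exact MeasurableSet.iUnion fun C => MeasurableSet.iInter fun n =>
      measurableSet_le (hbm n) measurable_const
  have hinv : T ⁻¹' G = G := by
    ext x
    constructor
    · rintro ⟨C, hC⟩
      obtain ⟨D, hD⟩ := exists_nat_ge (max 0 (f x + C))
      refine ⟨D, fun n => ?_⟩
      cases n with
      | zero => simp
      | succ n =>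
        rw [birkhoffSum_succ']
        exact (add_le_add le_rfl (hC n)).trans ((le_max_right _ _).trans hD)
    · rintro ⟨C, hC⟩
      obtain ⟨D, hD⟩ := exists_nat_ge (C - f x)
      refine ⟨D, fun n => ?_⟩
      have := hC (n + 1)
      rw [birkhoffSum_succ'] at this
      linarith
  have hpos : ¬ ∀ᵐ x ∂μ, x ∉ G := by
    intro hbad
    -- Off `G` some Birkhoff sum is positive. If `G` were null, these sets would exhaust the space
    -- up to a null set, and the maximal inequality would give `∫ f ≥ 0`.
    have hlim : Tendsto (fun N => ∫ x in {x | 0 < maxBirkhoffSum T f N x}, f x ∂μ) atTop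
        (𝓝 (∫ x in ⋃ N, {x | 0 < maxBirkhoffSum T f N x}, f x ∂μ)) := by
      refine tendsto_setIntegral_of_monotone (fun N => measurableSet_lt measurable_const
        (measurable_maxBirkhoffSum hT.measurable hfm N)) ?_ hf.integrableOn
      exact monotone_nat_of_le_succ fun N x hx => lt_of_lt_of_le hx (maxBirkhoffSum_le_succ N x)
    have h0 := ge_of_tendsto' hlim fun N =>
      setIntegral_nonneg_of_maxBirkhoffSum_pos hT.toMeasurePreserving hf hfm N
    have huniv : (⋃ N, {x | 0 < maxBirkhoffSum T f N x} : Set Ω) =ᵐ[μ] univ := by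
      rw [eventuallyEq_univ]
      filter_upwards [hbad] with x hx
      by_contra hcon
      simp only [mem_iUnion, mem_ofPred_eq, not_exists, not_lt] at hcon
      exact hx ⟨0, fun n => by
        simpa using (birkhoffSum_le_maxBirkhoffSum n x).trans (hcon n)⟩
    rw [setIntegral_congr_set huniv, setIntegral_univ] at h0
    linarith
  rcases hT.toPreErgodic.ae_mem_or_ae_notMem hGm hinv with h | h
  · filter_upwards [h] with x ⟨C, hC⟩
    exact ⟨C, hC⟩
  · exact absurd h hpos

/-- The upper half of the pointwise ergodic theorem. -/
lemma ae_eventually_birkhoffSum_le [IsProbabilityMeasure μ] (hT : Ergodic T μ)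
    (hf : Integrable f μ) (hfm : Measurable f) {l : ℝ} (hl : ∫ x, f x ∂μ < l) :
    ∀ᵐ x ∂μ, ∀ᶠ n : ℕ in atTop, birkhoffSum T f n x ≤ l * n := by
  -- The Birkhoff sums of `f - m` are bounded above, and the gap `(l - m) n` eventually exceeds the
  -- bound.
  obtain ⟨m, h1, h2⟩ := exists_between hl
  have hneg : ∫ x, (f x - m) ∂μ < 0 := by
    rw [integral_sub hf (integrable_const _)]
    simpa using h1
  filter_upwards [ae_bddAbove_birkhoffSum hT (hf.sub (integrable_const m))
    (hfm.sub measurable_const) hneg] with x ⟨C, hC⟩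
  filter_upwards [eventually_ge_atTop ⌈C / (l - m)⌉₊] with n hn
  have h3 : C ≤ n * (l - m) := (div_le_iff₀ (by linarith)).1 (Nat.ceil_le.1 hn)
  have h4 := hC n
  have h5 : birkhoffSum T (f - fun _ => m) n x = birkhoffSum T f n x - n * m := by
    simp [birkhoffSum, Finset.sum_sub_distrib]
  rw [h5] at h4
  linarith

/-- A Borel–Cantelli argument: the series `∑ e^{-δn} X n` has finite integral, so it converges
almost everywhere and its terms tend to 0. -/
lemma ae_eventually_le_exp_of_lintegral_le {X : ℕ → Ω → ENNReal} (hX : ∀ n, Measurable (X n))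
    {C : ENNReal} (hC : C ≠ ⊤) (h : ∀ n, ∫⁻ x, X n x ∂μ ≤ C) {δ : ℝ} (hδ : 0 < δ) :
    ∀ᵐ x ∂μ, ∀ᶠ n : ℕ in atTop, X n x ≤ ENNReal.ofReal (Real.exp (δ * n)) := by
  set q : ENNReal := ENNReal.ofReal (Real.exp (-δ)) with hq
  have hq1 : q < 1 := by
    rw [hq, ENNReal.ofReal_lt_one]
    simpa using hδ
  have hsum : ∫⁻ x, ∑' n, q ^ n * X n x ∂μ ≠ ⊤ := by
    rw [lintegral_tsum fun n => ((hX n).const_mul _).aemeasurable]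
    have : ∑' n, ∫⁻ x, q ^ n * X n x ∂μ ≤ (∑' n, q ^ n) * C := by
      rw [← ENNReal.tsum_mul_right]
      refine ENNReal.tsum_le_tsum fun n => ?_
      rw [lintegral_const_mul _ (hX n)]
      exact mul_le_mul_right (h n) _
    refine ne_top_of_le_ne_top (ENNReal.mul_ne_top ?_ hC) this
    rw [ENNReal.tsum_geometric, ENNReal.inv_ne_top]
    exact (tsub_pos_of_lt hq1).ne'
  have hmeas : Measurable fun x => ∑' n, q ^ n * X n x :=
    Measurable.tsum fun n => (hX n).const_mul _
  filter_upwards [ae_lt_top hmeas hsum] with x hx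
  have := ENNReal.tendsto_atTop_zero_of_tsum_ne_top hx.ne
  filter_upwards [this.eventually_le_const (u := 1) one_pos] with n hn
  have hqn : q ^ n = (ENNReal.ofReal (Real.exp (δ * n)))⁻¹ := by
    rw [hq, ← ENNReal.ofReal_pow (Real.exp_pos _).le, ← Real.exp_nat_mul,
      ← ENNReal.ofReal_inv_of_pos (Real.exp_pos _), ← Real.exp_neg]
    congr 2; ring
  rw [hqn, mul_comm, ← div_eq_mul_inv] at hn
  refine (ENNReal.div_le_iff ?_ ENNReal.ofReal_ne_top).1 hn |>.trans (one_mul _).le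
  exact (ENNReal.ofReal_pos.2 (Real.exp_pos _)).ne'

end RelativeDimension

/-! ### Conditional probabilities of the past and half of the Shannon–McMillan–Breiman theorem. -/

namespace RelativeDimension

variable {A : Type*} [MeasurableSpace A] [Finite A] [DiscreteMeasurableSpace A]

/-- The filtration of the first `n` coordinates. -/
noncomputable def wordFiltration (A : Type*) [MeasurableSpace A] :
    Filtration ℕ (inferInstance : MeasurableSpace (ℕ → A)) where
  seq n := MeasurableSpace.comap (firstWord n) inferInstance
  mono' := by
    intro m n hmn
    have : (firstWord m : (ℕ → A) → _) = (fun s i => s (Fin.castLE hmn i)) ∘ firstWord n := rfl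
    change MeasurableSpace.comap (firstWord m) _ ≤ MeasurableSpace.comap (firstWord n) _
    rw [this, ← MeasurableSpace.comap_comp]
    refine MeasurableSpace.comap_mono (Measurable.comap_le ?_)
    exact measurable_pi_lambda _ fun i => measurable_pi_apply _
  le' n := (measurable_firstWord n).comap_le

lemma iSup_wordFiltration :
    ⨆ n, wordFiltration A n = (inferInstance : MeasurableSpace (ℕ → A)) := by
  refine le_antisymm (iSup_le fun n => (wordFiltration A).le n) ?_
  refine (generateFrom_cylinder 0).le.trans ?_
  refine MeasurableSpace.generateFrom_le ?_
  rintro _ ⟨ω, n, -, rfl⟩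
  refine (le_iSup (wordFiltration A) n) _ ⟨{firstWord n ω}, MeasurableSet.of_discrete, ?_⟩
  rw [cylinder_eq_wordCylinder, wordCylinder_eq_preimage]

/-- On the finite set of words the quotient is the density of one image measure with respect to the
other; absolute continuity takes care of the `m`-null words. -/
lemma setLIntegral_cylinder_div (μ m : Measure (ℕ → A)) [IsFiniteMeasure m] (hμ : μ ≪ m) (n : ℕ)
    (T : Set (Fin n → A)) :
    ∫⁻ ω in firstWord n ⁻¹' T, μ (PiNat.cylinder ω n) / m (PiNat.cylinder ω n) ∂m =
      μ (firstWord n ⁻¹' T) := by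
  set h : (Fin n → A) → ENNReal := fun s => μ (wordCylinder s) / m (wordCylinder s) with hh
  have hw : (m.map (firstWord n)).withDensity h = μ.map (firstWord n) := by
    refine Measure.ext_of_singleton fun s => ?_
    rw [withDensity_apply _ MeasurableSet.of_discrete, lintegral_singleton,
      Measure.map_apply (measurable_firstWord n) MeasurableSet.of_discrete,
      Measure.map_apply (measurable_firstWord n) MeasurableSet.of_discrete,
      ← wordCylinder_eq_preimage]
    by_cases h0 : m (wordCylinder s) = 0
    · rw [h0, mul_zero, hμ h0]
    · exact ENNReal.div_mul_cancel h0 (measure_ne_top _ _)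
  rw [← Measure.map_apply (measurable_firstWord n) MeasurableSet.of_discrete, ← hw,
    withDensity_apply _ MeasurableSet.of_discrete,
    setLIntegral_map MeasurableSet.of_discrete (measurable_of_finite _) (measurable_firstWord n)]
  simp only [cylinder_eq_wordCylinder, hh]

lemma cylinder_div_ne_top {μ m : Measure (ℕ → A)} [IsFiniteMeasure μ] (hμ : μ ≪ m) (ω : ℕ → A)
    (n : ℕ) : μ (PiNat.cylinder ω n) / m (PiNat.cylinder ω n) ≠ ⊤ := by
  by_cases h0 : m (PiNat.cylinder ω n) = 0
  · simp [hμ h0]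
  · exact (ENNReal.div_lt_top (measure_ne_top _ _) h0).ne

/-- Martingale convergence for the densities of cylinders. -/
lemma tendsto_eLpNorm_cylinder_div_sub_rnDeriv {μ m : Measure (ℕ → A)} [IsFiniteMeasure μ]
    [IsFiniteMeasure m] (hμ : μ ≪ m) :
    Tendsto (fun n => eLpNorm (fun ω =>
      (μ (PiNat.cylinder ω n) / m (PiNat.cylinder ω n)).toReal - (μ.rnDeriv m ω).toReal) 1 m)
      atTop (𝓝 0) := by
  have hg : Integrable (fun ω => (μ.rnDeriv m ω).toReal) m := Measure.integrable_toReal_rnDeriv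
  have hgm : StronglyMeasurable[⨆ n, wordFiltration A n]
      (fun ω => (μ.rnDeriv m ω).toReal) := by
    rw [iSup_wordFiltration]
    exact (Measure.measurable_rnDeriv μ m).ennreal_toReal.stronglyMeasurable
  -- The quotient on `n`-cylinders is the conditional expectation of the density given the first `n`
  -- letters, so this is Lévy's upward theorem in `L¹`.
  refine (hg.tendsto_eLpNorm_condExp hgm).congr fun n => eLpNorm_congr_ae ?_
  have hmeas : Measurable fun ω : ℕ → A => μ (PiNat.cylinder ω n) / m (PiNat.cylinder ω n) :=
    (measurable_measure_cylinder μ n).div (measurable_measure_cylinder m n)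
  have hlt : ∫⁻ ω, μ (PiNat.cylinder ω n) / m (PiNat.cylinder ω n) ∂m ≠ ⊤ := by
    have := setLIntegral_cylinder_div μ m hμ n univ
    rw [preimage_univ, Measure.restrict_univ] at this
    rw [this]
    exact measure_ne_top _ _
  have hq : Integrable (fun ω => (μ (PiNat.cylinder ω n) / m (PiNat.cylinder ω n)).toReal) m :=
    integrable_toReal_of_lintegral_ne_top hmeas.aemeasurable hlt
  have key := ae_eq_condExp_of_forall_setIntegral_eq ((wordFiltration A).le n) hg
    (g := fun ω => (μ (PiNat.cylinder ω n) / m (PiNat.cylinder ω n)).toReal)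
    (fun s _ _ => hq.integrableOn) ?_ ?_
  · filter_upwards [key] with ω hω
    rw [Pi.sub_apply, ← hω]
  · rintro _ ⟨T, -, rfl⟩ -
    rw [integral_toReal hmeas.aemeasurable
      (Eventually.of_forall fun ω => (cylinder_div_ne_top hμ ω n).lt_top),
      setLIntegral_cylinder_div μ m hμ n T, Measure.setIntegral_toReal_rnDeriv hμ]
    rfl
  · have : (fun ω => (μ (PiNat.cylinder ω n) / m (PiNat.cylinder ω n)).toReal) =
        (fun s : Fin n → A => (μ (wordCylinder s) / m (wordCylinder s)).toReal) ∘
          firstWord n := by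
      ext ω; simp only [cylinder_eq_wordCylinder, Function.comp]
    rw [this]
    refine Measurable.aestronglyMeasurable ?_
    exact (measurable_of_finite _).comp (comap_measurable _)

/-- Each word `s` contributes `(κ[s] / μ[s]) μ[s] ≤ κ[s]`. No absolute continuity is needed, as a
`μ`-null word contributes 0. -/
lemma lintegral_cylinder_div_le (κ μ : Measure (ℕ → A)) [IsFiniteMeasure μ] (n : ℕ) :
    ∫⁻ ω, κ (PiNat.cylinder ω n) / μ (PiNat.cylinder ω n) ∂μ ≤ κ univ := by
  cases nonempty_fintype A
  have h1 : ∫⁻ ω, κ (PiNat.cylinder ω n) / μ (PiNat.cylinder ω n) ∂μ =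
      ∫⁻ s, κ (wordCylinder s) / μ (wordCylinder s) ∂(μ.map (firstWord n)) := by
    rw [lintegral_map (measurable_of_finite _) (measurable_firstWord n)]
    simp only [cylinder_eq_wordCylinder]
  rw [h1, lintegral_fintype, ← sum_measure_wordCylinder κ n]
  refine Finset.sum_le_sum fun s _ => ?_
  rw [Measure.map_apply (measurable_firstWord n) MeasurableSet.of_discrete,
    ← wordCylinder_eq_preimage]
  rw [mul_comm]
  exact ENNReal.mul_div_le

/-- The sum over `a` of the images of `μ` under `ω ↦ aω`. -/
noncomputable def prependMeasure (μ : Measure (ℕ → A)) : Measure (ℕ → A) :=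
  Measure.sum fun a => μ.map (prepend a)

instance (μ : Measure (ℕ → A)) [IsFiniteMeasure μ] : IsFiniteMeasure (prependMeasure μ) := by
  cases nonempty_fintype A
  unfold prependMeasure
  infer_instance

lemma prependMeasure_univ (μ : Measure (ℕ → A)) [IsProbabilityMeasure μ] :
    prependMeasure μ univ = (Nat.card A : ENNReal) := by
  cases nonempty_fintype A
  rw [prependMeasure, Measure.sum_apply _ MeasurableSet.univ]
  simp [Measure.map_apply (measurable_prepend _) MeasurableSet.univ, Nat.card_eq_fintype_card]

/-- This domination provides the density `pastDensity` and transfers `L¹` convergence from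
`prependMeasure μ` to `μ`. -/
lemma le_prependMeasure {μ : Measure (ℕ → A)} (hμ : MeasurePreserving shift μ μ) :
    μ ≤ prependMeasure μ := by
  refine Measure.le_iff.2 fun E hE => ?_
  rw [prependMeasure, Measure.sum_apply _ hE]
  have hsub : E ⊆ ⋃ a, shift ⁻¹' (prepend a ⁻¹' E) := fun ω hω =>
    mem_iUnion.2 ⟨ω 0, by rwa [mem_preimage, mem_preimage, prepend_shift]⟩
  refine (measure_mono hsub).trans ((measure_iUnion_le _).trans (ENNReal.tsum_le_tsum fun a => ?_))
  rw [hμ.measure_preimage (measurable_prepend a hE).nullMeasurableSet,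
    Measure.map_apply (measurable_prepend a) hE]

/-- Hence quotients of `μ` by `prependMeasure μ` on cylinders are conditional probabilities of `ω_0`
given the following letters. -/
lemma prependMeasure_cylinder (μ : Measure (ℕ → A)) (ω : ℕ → A) (n : ℕ) :
    prependMeasure μ (PiNat.cylinder ω (n + 1)) = μ (PiNat.cylinder (shift ω) n) := by
  rw [prependMeasure, Measure.sum_apply _ (measurableSet_cylinder _ _), tsum_eq_single (ω 0)]
  · rw [Measure.map_apply (measurable_prepend _) (measurableSet_cylinder _ _)]
    congr 1
    ext τ
    simp only [mem_preimage, mem_cylinder_succ_iff, prepend_zero, shift_prepend, true_and]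
  · intro a ha
    rw [Measure.map_apply (measurable_prepend _) (measurableSet_cylinder _ _)]
    convert measure_empty (μ := μ)
    ext τ
    simp only [mem_preimage, mem_cylinder_succ_iff, prepend_zero, ha, false_and,
      mem_empty_iff_false]

/-- The density of a shift-invariant measure with respect to `prependMeasure`: the conditional
probability of `ω_0` given `ω_1, ω_2, …`. -/
noncomputable def pastDensity (μ : Measure (ℕ → A)) : (ℕ → A) → ENNReal :=
  μ.rnDeriv (prependMeasure μ)

lemma measurable_pastDensity (μ : Measure (ℕ → A)) : Measurable (pastDensity μ) :=
  Measure.measurable_rnDeriv _ _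

lemma ae_pastDensity_pos {μ : Measure (ℕ → A)} [IsProbabilityMeasure μ]
    (hμ : MeasurePreserving shift μ μ) :
    ∀ᵐ ω ∂μ, 0 < pastDensity μ ω ∧ pastDensity μ ω ≠ ⊤ := by
  have hac : μ ≪ prependMeasure μ := Measure.absolutelyContinuous_of_le (le_prependMeasure hμ)
  filter_upwards [Measure.rnDeriv_pos hac, hac (Measure.rnDeriv_ne_top μ (prependMeasure μ))]
    with ω h1 h2
  exact ⟨h1, h2⟩

/-- Since `μ` has density `pastDensity μ` with respect to `prependMeasure μ`, dividing by it turns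
an integral over `μ` into a sum over the letters put in front. Only `≤` is claimed, as the density
may vanish. -/
lemma lintegral_div_pastDensity_le {μ : Measure (ℕ → A)} [IsProbabilityMeasure μ]
    (hμ : MeasurePreserving shift μ μ) {F : (ℕ → A) → ENNReal} (hF : Measurable F) :
    ∫⁻ ω, F ω / pastDensity μ ω ∂μ ≤ ∫⁻ ω, ∑' a, F (prepend a ω) ∂μ := by
  have hac : μ ≪ prependMeasure μ := Measure.absolutelyContinuous_of_le (le_prependMeasure hμ)
  have h1 : ∫⁻ ω, F ω / pastDensity μ ω ∂μ =
      ∫⁻ ω, pastDensity μ ω * (F ω / pastDensity μ ω) ∂(prependMeasure μ) :=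
    (lintegral_rnDeriv_mul hac (hF.div (measurable_pastDensity μ)).aemeasurable).symm
  have h2 : ∫⁻ ω, F ω ∂(prependMeasure μ) = ∫⁻ ω, ∑' a, F (prepend a ω) ∂μ := by
    rw [prependMeasure, lintegral_sum_measure, lintegral_tsum (f := fun a ω => F (prepend a ω))
      fun a => (hF.comp (measurable_prepend a)).aemeasurable]
    exact tsum_congr fun a => lintegral_map hF (measurable_prepend a)
  rw [h1, ← h2]
  exact lintegral_mono fun ω => ENNReal.mul_div_le

lemma sum_measure_cylinder_prepend (μ : Measure (ℕ → A)) (ω : ℕ → A) (n : ℕ) :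
    ∑' a, μ (PiNat.cylinder (prepend a ω) (n + 1)) = μ (shift ⁻¹' PiNat.cylinder ω n) := by
  rw [← measure_iUnion]
  · congr 1
    ext τ
    simp only [mem_iUnion, mem_preimage, mem_cylinder_succ_iff, prepend_zero, shift_prepend,
      exists_and_right, exists_eq', true_and]
  · intro a b hab
    refine disjoint_left.2 fun τ h1 h2 => hab ?_
    rw [mem_cylinder_succ_iff] at h1 h2
    exact h1.1.symm.trans h2.1
  · exact fun a => measurableSet_cylinder _ _

/-- Induction on the length: dividing by the density at `ω` sums over the first letter, and by
invariance the cylinders `[a ω|_n]` add up to `μ[ω|_n]`, while the other factors do not see that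
letter. -/
lemma lintegral_cylinder_div_prod_le {μ : Measure (ℕ → A)} [IsProbabilityMeasure μ]
    (hμ : MeasurePreserving shift μ μ) (n : ℕ) :
    ∫⁻ ω, μ (PiNat.cylinder ω n) / ∏ j ∈ Finset.range n, pastDensity μ (shift^[j] ω) ∂μ ≤ 1 := by
  induction n with
  | zero => simp
  | succ n ih =>
    have hmeas : ∀ j, Measurable fun ω => pastDensity μ (shift^[j] ω) := fun j =>
      (measurable_pastDensity μ).comp (measurable_shift.iterate j)
    have hF : Measurable fun ω : ℕ → A => μ (PiNat.cylinder ω (n + 1)) /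
        ∏ j ∈ Finset.range n, pastDensity μ (shift^[j] (shift ω)) :=
      (measurable_measure_cylinder μ _).div
        ((Finset.measurable_prod _ fun j _ => hmeas j).comp measurable_shift)
    have h := lintegral_div_pastDensity_le hμ hF
    simp only [shift_prepend] at h
    have h1 : ∀ ω, ∑' a, μ (PiNat.cylinder (prepend a ω) (n + 1)) /
        ∏ j ∈ Finset.range n, pastDensity μ (shift^[j] ω) = μ (PiNat.cylinder ω n) /
          ∏ j ∈ Finset.range n, pastDensity μ (shift^[j] ω) := by
      intro ω
      simp only [div_eq_mul_inv]
      rw [ENNReal.tsum_mul_right, sum_measure_cylinder_prepend,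
        hμ.measure_preimage (measurableSet_cylinder ω n).nullMeasurableSet]
    simp only [h1] at h
    refine (lintegral_mono_ae ?_).trans (h.trans ih)
    filter_upwards [ae_pastDensity_pos hμ] with ω ⟨h0, h1⟩
    rw [Finset.prod_range_succ', Function.iterate_zero, id]
    simp only [Function.iterate_succ_apply]
    rw [div_eq_mul_inv, ENNReal.mul_inv (Or.inr h1) (Or.inr h0.ne'), ← mul_assoc,
      ← div_eq_mul_inv, ← div_eq_mul_inv]

/-- The conditional probability of `ω_0` given `ω_1, …, ω_k`. -/
noncomputable def pastQuotient (μ : Measure (ℕ → A)) (k : ℕ) (ω : ℕ → A) : ℝ :=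
  μ.real (PiNat.cylinder ω (k + 1)) / μ.real (PiNat.cylinder (shift ω) k)

lemma pastQuotient_eq (μ : Measure (ℕ → A)) (k : ℕ) (ω : ℕ → A) :
    pastQuotient μ k ω =
      (μ (PiNat.cylinder ω (k + 1)) / prependMeasure μ (PiNat.cylinder ω (k + 1))).toReal := by
  rw [ENNReal.toReal_div, prependMeasure_cylinder]
  rfl

lemma measurable_pastQuotient (μ : Measure (ℕ → A)) (k : ℕ) : Measurable (pastQuotient μ k) :=
  (measurable_measure_cylinder μ _).ennreal_toReal.div
    ((measurable_measure_cylinder μ _).ennreal_toReal.comp measurable_shift)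

/-- Martingale convergence takes place in `L¹` of `prependMeasure μ`, which dominates `μ`. -/
lemma tendsto_lintegral_pastQuotient_sub {μ : Measure (ℕ → A)} [IsProbabilityMeasure μ]
    (hμ : MeasurePreserving shift μ μ) :
    Tendsto (fun k => ∫⁻ ω, ‖pastQuotient μ k ω - (pastDensity μ ω).toReal‖ₑ ∂μ)
      atTop (𝓝 0) := by
  have hac : μ ≪ prependMeasure μ := Measure.absolutelyContinuous_of_le (le_prependMeasure hμ)
  have h := (tendsto_add_atTop_iff_nat 1).2 (tendsto_eLpNorm_cylinder_div_sub_rnDeriv hac)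
  refine tendsto_of_tendsto_of_tendsto_of_le_of_le tendsto_const_nhds h (fun _ => zero_le)
    fun k => ?_
  simp only [eLpNorm_one_eq_lintegral_enorm, ← pastQuotient_eq]
  exact lintegral_mono' (le_prependMeasure hμ) le_rfl

/-- The bound is uniform in `k`; it stands in for a lower bound on the conditional probabilities
when their logarithms are compared. -/
lemma lintegral_inv_pastQuotient_le {μ : Measure (ℕ → A)} [IsProbabilityMeasure μ] (k : ℕ) :
    ∫⁻ ω, ‖(pastQuotient μ k ω)⁻¹‖ₑ ∂μ ≤ (Nat.card A : ENNReal) := by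
  rw [← prependMeasure_univ μ]
  refine le_trans (lintegral_mono_ae ?_)
    (lintegral_cylinder_div_le (prependMeasure μ) μ (k + 1))
  filter_upwards [ae_measure_cylinder_pos μ] with ω hω
  rw [pastQuotient_eq, ← ENNReal.toReal_inv, ENNReal.inv_div (Or.inl (measure_ne_top _ _))
    (Or.inr (hω _).ne')]
  rw [Real.enorm_of_nonneg ENNReal.toReal_nonneg]
  exact ENNReal.ofReal_toReal_le

/-- One half of the Shannon–McMillan–Breiman theorem, in comparison with the Markov
approximations. -/
lemma exists_ae_eventually_cylinder_le {μ : Measure (ℕ → A)} [IsProbabilityMeasure μ]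
    (hμ : Ergodic shift μ) {δ : ℝ} (hδ : 0 < δ) :
    ∃ k, 1 ≤ k ∧ ∀ᵐ ω ∂μ, ∀ᶠ n : ℕ in atTop, μ.real (PiNat.cylinder ω n) ≤
      Real.exp (δ * n) * ∏ j ∈ Finset.range n, pastQuotient μ k (shift^[j] ω) := by
  have hinv := hμ.toMeasurePreserving
  -- The order of choices matters: `s` makes the term with `q⁻¹` small for all `k` at once, then `k`
  -- makes the `L¹` distance small relative to `s`.
  obtain ⟨s, hs0, hs⟩ : ∃ s : ℝ, 0 < s ∧ s⁻¹ * (Nat.card A : ℝ) < δ / 4 := by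
    refine ⟨4 * (Nat.card A + 1) / δ, by positivity, ?_⟩
    rw [inv_div, div_mul_eq_mul_div, div_lt_div_iff₀ (by positivity) (by norm_num)]
    nlinarith
  obtain ⟨k, hk, hk1⟩ := (((tendsto_lintegral_pastQuotient_sub hinv).eventually_lt_const
    (u := ENNReal.ofReal (s⁻¹ * (δ / 4))) (by simp; positivity)).and
      (eventually_ge_atTop 1)).exists
  refine ⟨k, hk1, ?_⟩
  have hqm := measurable_pastQuotient μ k
  have hgm := (measurable_pastDensity μ).ennreal_toReal
  have hq1 : Integrable (fun ω => pastQuotient μ k ω - (pastDensity μ ω).toReal) μ :=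
    ⟨(hqm.sub hgm).aestronglyMeasurable, hk.trans ENNReal.ofReal_lt_top⟩
  have hq2 : Integrable (fun ω => (pastQuotient μ k ω)⁻¹) μ :=
    ⟨hqm.inv.aestronglyMeasurable,
      (lintegral_inv_pastQuotient_le k).trans_lt (ENNReal.natCast_lt_top _)⟩
  -- An integrable upper bound for `log (g / q)`, with `g` the density and `q` the quotient: `g / q
  -- ≤ 1 + |q - g| / q`, and `1 + ab ≤ (1 + a)(1 + b) ≤ e^{a + b}` for `a = s |q - g|`, `b = (s
  -- q)⁻¹`.
  set φ : (ℕ → A) → ℝ := fun ω => s * |pastQuotient μ k ω - (pastDensity μ ω).toReal| +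
    s⁻¹ * |(pastQuotient μ k ω)⁻¹| with hφ
  have hφi : Integrable φ μ := (hq1.abs.const_mul s).add (hq2.abs.const_mul s⁻¹)
  have hφm : Measurable φ :=
    ((hqm.sub hgm).abs.const_mul s).add (hqm.inv.abs.const_mul s⁻¹)
  have hφint : ∫ ω, φ ω ∂μ < δ / 2 := by
    rw [integral_add (hq1.abs.const_mul s) (hq2.abs.const_mul s⁻¹), integral_const_mul,
      integral_const_mul]
    have h1 : ∫ ω, |pastQuotient μ k ω - (pastDensity μ ω).toReal| ∂μ < s⁻¹ * (δ / 4) := by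
      simp only [← Real.norm_eq_abs]
      rw [integral_norm_eq_lintegral_enorm hq1.1]
      exact ENNReal.toReal_lt_of_lt_ofReal hk
    have h2 : ∫ ω, |(pastQuotient μ k ω)⁻¹| ∂μ ≤ Nat.card A := by
      simp only [← Real.norm_eq_abs]
      rw [integral_norm_eq_lintegral_enorm hq2.1]
      exact ENNReal.toReal_le_of_le_ofReal (by positivity)
        (by simpa using lintegral_inv_pastQuotient_le k)
    have h3 : s * ∫ ω, |pastQuotient μ k ω - (pastDensity μ ω).toReal| ∂μ < δ / 4 := by
      have := mul_lt_mul_of_pos_left h1 hs0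
      rwa [← mul_assoc, mul_inv_cancel₀ hs0.ne', one_mul] at this
    have h4 := mul_le_mul_of_nonneg_left h2 (inv_pos.2 hs0).le
    linarith
  have hX := ae_eventually_le_exp_of_lintegral_le (μ := μ) (X := fun n ω =>
      μ (PiNat.cylinder ω n) / ∏ j ∈ Finset.range n, pastDensity μ (shift^[j] ω))
    (fun n => (measurable_measure_cylinder μ n).div (Finset.measurable_prod _ fun j _ =>
      (measurable_pastDensity μ).comp (measurable_shift.iterate j))) ENNReal.one_ne_top
    (lintegral_cylinder_div_prod_le hinv) (half_pos hδ)
  have hg : ∀ᵐ ω ∂μ, ∀ j, 0 < pastDensity μ (shift^[j] ω) ∧ pastDensity μ (shift^[j] ω) ≠ ⊤ :=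
    ae_all_iff.2 fun j => (hinv.iterate j).quasiMeasurePreserving.ae (ae_pastDensity_pos hinv)
  filter_upwards [hX, hg, ae_eventually_birkhoffSum_le hμ hφi hφm hφint,
    ae_measure_cylinder_iterate_pos hinv] with ω hω hgω hS hpos
  filter_upwards [hω, hS] with n hn hSn
  have hstep : ∀ j, (pastDensity μ (shift^[j] ω)).toReal ≤
      pastQuotient μ k (shift^[j] ω) * Real.exp (φ (shift^[j] ω)) := by
    intro j
    set q := pastQuotient μ k (shift^[j] ω) with hq
    set g := (pastDensity μ (shift^[j] ω)).toReal
    have hq0 : 0 < q := div_pos (ENNReal.toReal_pos (hpos _ _).ne' (measure_ne_top _ _))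
      (by rw [← Function.iterate_succ_apply' shift]
          exact ENNReal.toReal_pos (hpos _ _).ne' (measure_ne_top _ _))
    have h1 : φ (shift^[j] ω) = s * |q - g| + s⁻¹ * q⁻¹ := by
      rw [hφ]
      simp only [← hq, abs_of_pos (inv_pos.2 hq0)]
      rfl
    have h2 : 1 + |q - g| * q⁻¹ ≤ Real.exp (φ (shift^[j] ω)) := by
      rw [h1, Real.exp_add]
      have ha := Real.add_one_le_exp (s * |q - g|)
      have hb := Real.add_one_le_exp (s⁻¹ * q⁻¹)
      have ha0 : 0 ≤ s * |q - g| := by positivity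
      have hb0 : 0 ≤ s⁻¹ * q⁻¹ := by positivity
      refine le_trans ?_ (mul_le_mul ha hb (by positivity) (Real.exp_pos _).le)
      have : |q - g| * q⁻¹ = (s * |q - g|) * (s⁻¹ * q⁻¹) := by field_simp
      rw [this]
      nlinarith
    refine le_trans ?_ (mul_le_mul_of_nonneg_left h2 hq0.le)
    rw [mul_add, mul_one, mul_left_comm, mul_inv_cancel₀ hq0.ne', mul_one]
    linarith [neg_abs_le (q - g)]
  have hprod : ∏ j ∈ Finset.range n, pastDensity μ (shift^[j] ω) ≠ ⊤ :=
    ENNReal.prod_ne_top fun j _ => (hgω j).2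
  have hprod0 : ∏ j ∈ Finset.range n, pastDensity μ (shift^[j] ω) ≠ 0 :=
    Finset.prod_ne_zero_iff.2 fun j _ => (hgω j).1.ne'
  have h1 : μ.real (PiNat.cylinder ω n) ≤
      Real.exp (δ / 2 * n) * ∏ j ∈ Finset.range n, (pastDensity μ (shift^[j] ω)).toReal := by
    have := ENNReal.toReal_mono (ENNReal.mul_ne_top ENNReal.ofReal_ne_top hprod)
      ((ENNReal.div_le_iff hprod0 hprod).1 hn)
    rwa [ENNReal.toReal_mul, ENNReal.toReal_ofReal (Real.exp_pos _).le,
      ENNReal.toReal_prod] at this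
  have h2 : ∏ j ∈ Finset.range n, (pastDensity μ (shift^[j] ω)).toReal ≤
      (∏ j ∈ Finset.range n, pastQuotient μ k (shift^[j] ω)) * Real.exp (δ / 2 * n) := by
    refine (Finset.prod_le_prod (fun _ _ => ENNReal.toReal_nonneg) fun j _ => hstep j).trans ?_
    rw [Finset.prod_mul_distrib, ← Real.exp_sum]
    refine mul_le_mul_of_nonneg_left (Real.exp_le_exp.2 hSn) (Finset.prod_nonneg fun j _ => ?_)
    exact div_nonneg ENNReal.toReal_nonneg ENNReal.toReal_nonneg
  refine h1.trans ((mul_le_mul_of_nonneg_left h2 (Real.exp_pos _).le).trans_eq ?_)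
  rw [mul_left_comm, ← Real.exp_add, mul_comm]
  congr 2; ring

end RelativeDimension

/-! ### Stationary vectors, rational rounding and the law of a finite-order Markov chain. -/

namespace RelativeDimension

/-- A stochastic matrix has a stationary distribution. -/
lemma exists_stationary {X : Type*} [Fintype X] [Nonempty X] [DecidableEq X] (M : Matrix X X ℝ)
    (hM : ∀ i j, 0 ≤ M i j) (hrow : ∀ i, ∑ j, M i j = 1) :
    ∃ v : X → ℝ, (∀ i, 0 ≤ v i) ∧ ∑ i, v i = 1 ∧ ∀ j, ∑ i, v i * M i j = v j := by
  -- The constant vector is a right null vector of `M - 1`, so there is a left null vector too,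
  -- possibly with signs.
  have hdet : (M - 1).det = 0 := by
    refine Matrix.exists_mulVec_eq_zero_iff.1 ⟨fun _ => 1, ?_, ?_⟩
    · exact fun h => one_ne_zero (congrFun h (Classical.arbitrary X))
    · ext i
      rw [Matrix.sub_mulVec, Matrix.one_mulVec]
      simp [Matrix.mulVec, dotProduct, hrow]
  obtain ⟨v, hv0, hv⟩ := Matrix.exists_vecMul_eq_zero_iff.2 hdet
  have hv' : ∀ j, ∑ i, v i * M i j = v j := by
    intro j
    have := congrFun hv j
    rw [Matrix.vecMul_sub, Matrix.vecMul_one, Pi.sub_apply, Pi.zero_apply, sub_eq_zero] at this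
    exact this
  have hle : ∀ j ∈ Finset.univ, |v j| ≤ ∑ i, |v i| * M i j := by
    intro j _
    conv_lhs => rw [← hv' j]
    refine (Finset.abs_sum_le_sum_abs _ _).trans_eq (Finset.sum_congr rfl fun i _ => ?_)
    rw [abs_mul, abs_of_nonneg (hM i j)]
  have hsum : ∑ j, |v j| = ∑ j, ∑ i, |v i| * M i j := by
    rw [Finset.sum_comm]
    simp only [← Finset.mul_sum, hrow, mul_one]
  -- The vector `|v|` satisfies `|v| ≤ |v| M` entrywise and both sides have the same total, so it is
  -- stationary itself.
  have heq := (Finset.sum_eq_sum_iff_of_le hle).1 hsum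
  have hpos : 0 < ∑ j, |v j| := by
    obtain ⟨i, hi⟩ := Function.ne_iff.1 hv0
    exact Finset.sum_pos' (fun j _ => abs_nonneg _) ⟨i, Finset.mem_univ _, abs_pos.2 hi⟩
  refine ⟨fun i => |v i| / ∑ j, |v j|, fun i => by positivity, ?_, fun j => ?_⟩
  · rw [← Finset.sum_div, div_self hpos.ne']
  · have h : |v j| / ∑ i, |v i| = (∑ i, |v i| * M i j) / ∑ i, |v i| := by
      rw [← heq j (Finset.mem_univ _)]
    refine Eq.trans ?_ h.symm
    rw [Finset.sum_div]
    exact Finset.sum_congr rfl fun i _ => by ring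

/-- The stationary distribution of a matrix that is stochastic on a closed set of states. -/
lemma exists_stationary_of_closed {S : Type*} [Fintype S] [DecidableEq S] (X : Set S)
    (hX : X.Nonempty) (M : S → S → ℝ) (hM : ∀ i j, 0 ≤ M i j) (hrow : ∀ i ∈ X, ∑ j, M i j = 1)
    (hclosed : ∀ i ∈ X, ∀ j, M i j ≠ 0 → j ∈ X) :
    ∃ v : S → ℝ, (∀ i, 0 ≤ v i) ∧ (∀ i, v i ≠ 0 → i ∈ X) ∧ ∑ i, v i = 1 ∧
      ∀ j, ∑ i, v i * M i j = v j := by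
  classical
  have : Nonempty X := hX.to_subtype
  have hsum : ∀ g : S → ℝ, (∀ i, g i ≠ 0 → i ∈ X) → ∑ i, g i = ∑ i : X, g i := by
    intro g hg
    refine (Fintype.sum_of_injective _ Subtype.val_injective _ g (fun i hi => ?_)
      fun _ => rfl).symm
    by_contra h
    exact hi ⟨⟨i, hg i h⟩, rfl⟩
  obtain ⟨v, h0, h1, h2⟩ := exists_stationary (X := X) (fun i j => M i j) (fun i j => hM i j)
    (fun i => by rw [← hsum (fun j => M i j) (hclosed i i.2)]; exact hrow i i.2)
  set w : S → ℝ := fun i => if h : i ∈ X then v ⟨i, h⟩ else 0 with hw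
  have hwX : ∀ i, w i ≠ 0 → i ∈ X := by
    intro i hi
    by_contra h
    exact hi (dif_neg h)
  have hwv : ∀ i : X, w i = v i := fun i => dif_pos i.2
  refine ⟨w, fun i => ?_, hwX, ?_, fun j => ?_⟩
  · by_cases h : i ∈ X
    · exact (hwv ⟨i, h⟩).symm ▸ h0 _
    · rw [show w i = 0 from dif_neg h]
  · rw [hsum w hwX]
    simpa only [hwv] using h1
  · rw [hsum (fun i => w i * M i j) fun i hi => hwX i (left_ne_zero_of_mul hi)]
    simp only [hwv]
    by_cases h : j ∈ X
    · rw [hwv ⟨j, h⟩, ← h2 ⟨j, h⟩]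
    · rw [show w j = 0 from dif_neg h]
      refine Finset.sum_eq_zero fun i _ => ?_
      rw [show M i j = 0 from not_not.1 fun hne => h (hclosed i i.2 j hne), mul_zero]

/-- A probability vector is bounded, up to a factor close to one, by a rational probability vector
with the same support. -/
lemma exists_rat_stochastic {A : Type*} [Fintype A] (p : A → ℝ) (h0 : ∀ a, 0 ≤ p a)
    (h1 : ∑ a, p a = 1) {δ : ℝ} (hδ : 0 < δ) :
    ∃ q : A → ℚ, (∀ a, 0 ≤ q a) ∧ ∑ a, q a = 1 ∧ (∀ a, 0 < q a ↔ 0 < p a) ∧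
      ∀ a, p a ≤ Real.exp δ * q a := by
  -- Each positive weight is rounded up by a factor at most `e^δ`. The sum of the rounded weights
  -- lies in `[1, e^δ]`, so normalizing costs at most that factor.
  have hex : ∀ a, ∃ r : ℚ, 0 ≤ r ∧ (0 < r ↔ 0 < p a) ∧ p a ≤ r ∧ (r : ℝ) ≤ Real.exp δ * p a := by
    intro a
    rcases (h0 a).eq_or_lt with h | h
    · exact ⟨0, le_rfl, by simp [← h], by simp [← h], by simp [← h]⟩
    · obtain ⟨r, hr1, hr2⟩ := exists_rat_btwn
        (lt_mul_of_one_lt_left h (Real.one_lt_exp_iff.2 hδ))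
      have hr : (0 : ℝ) < r := h.trans hr1
      have hr' : 0 < r := by exact_mod_cast hr
      exact ⟨r, hr'.le, by simp [hr', h], hr1.le, hr2.le⟩
  choose r hr0 hrpos hr1 hr2 using hex
  have hge : (1 : ℝ) ≤ ∑ a, (r a : ℝ) := by
    rw [← h1]; exact Finset.sum_le_sum fun a _ => hr1 a
  have hle : ∑ a, (r a : ℝ) ≤ Real.exp δ := by
    refine (Finset.sum_le_sum fun a _ => hr2 a).trans_eq ?_
    rw [← Finset.mul_sum, h1, mul_one]
  have hgeq : (1 : ℚ) ≤ ∑ a, r a := by exact_mod_cast hge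
  have hpos : 0 < ∑ a, r a := one_pos.trans_le hgeq
  refine ⟨fun a => r a / ∑ b, r b, fun a => div_nonneg (hr0 a) hpos.le, ?_, fun a => ?_,
    fun a => ?_⟩
  · rw [← Finset.sum_div, div_self hpos.ne']
  · rw [← hrpos a, div_pos_iff_of_pos_right hpos]
  · push_cast
    rw [mul_div_assoc', le_div_iff₀ (one_pos.trans_le hge), mul_comm]
    exact mul_le_mul hle (hr1 a) (h0 a) (Real.exp_pos _).le

variable {A : Type*}

/-- The sequence that starts with the word `s` and is continued by applying the maps `g_j` to the
preceding `k` letters. -/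
def recursivePath {k : ℕ} (s : Fin k → A) (g : ℕ → (Fin k → A) → A) (n : ℕ) : A :=
  if h : n < k then s ⟨n, h⟩ else g (n - k) fun i => recursivePath s g (n - k + i)
termination_by n
decreasing_by omega

lemma recursivePath_add {k : ℕ} (s : Fin k → A) (g : ℕ → (Fin k → A) → A) (j : ℕ) :
    recursivePath s g (j + k) = g j fun i => recursivePath s g (j + i) := by
  rw [recursivePath, dif_neg (by omega)]
  simp

lemma firstWord_shift_iterate (ω : ℕ → A) (j k : ℕ) :
    firstWord k (shift^[j] ω) = fun i : Fin k => ω (j + i) := by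
  ext i; rw [firstWord, shift_iterate_apply, add_comm]

/-- A cylinder prescribes `s` and one value of each of `m` different maps `g j`; for independent
random data its probability is therefore a product. -/
lemma recursivePath_mem_cylinder_iff {k : ℕ} (s : Fin k → A) (g : ℕ → (Fin k → A) → A)
    (ω : ℕ → A) (m : ℕ) : recursivePath s g ∈ PiNat.cylinder ω (k + m) ↔
      s = firstWord k ω ∧ ∀ j < m, g j (firstWord k (shift^[j] ω)) = ω (j + k) := by
  constructor
  · intro h
    refine ⟨?_, fun j hj => ?_⟩
    · ext i
      rw [firstWord, ← h i (by omega), recursivePath, dif_pos i.2]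
    · rw [← h (j + k) (by omega), recursivePath_add, firstWord_shift_iterate]
      congr 1; ext i
      exact (h (j + i) (by omega)).symm
  · rintro ⟨rfl, h⟩ i
    induction i using Nat.strong_induction_on with
    | _ i ih =>
      intro hi
      by_cases hik : i < k
      · rw [recursivePath, dif_pos hik]; rfl
      · obtain ⟨j, rfl⟩ : ∃ j, i = j + k := ⟨i - k, by omega⟩
        rw [recursivePath_add, ← h j (by omega), firstWord_shift_iterate]
        congr 1; ext i
        exact ih (j + i) (by omega) (by omega)

variable [MeasurableSpace A] [Finite A] [DiscreteMeasurableSpace A]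

lemma measurable_recursivePath (k : ℕ) : Measurable
    fun p : (Fin k → A) × (ℕ → (Fin k → A) → A) => recursivePath p.1 p.2 := by
  refine measurable_pi_lambda _ fun n => ?_
  induction n using Nat.strong_induction_on with
  | _ n ih =>
    by_cases h : n < k
    · have : (fun p : (Fin k → A) × (ℕ → (Fin k → A) → A) => recursivePath p.1 p.2 n) =
          fun p => p.1 ⟨n, h⟩ := by
        ext p; rw [recursivePath, dif_pos h]
      rw [this]
      exact (measurable_pi_apply _).comp measurable_fst
    · have : (fun p : (Fin k → A) × (ℕ → (Fin k → A) → A) => recursivePath p.1 p.2 n) =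
          (fun q : ((Fin k → A) → A) × (Fin k → A) => q.1 q.2) ∘ fun p =>
            (p.2 (n - k), fun i : Fin k => recursivePath p.1 p.2 (n - k + i)) := by
        ext p; rw [recursivePath, dif_neg h]; rfl
      rw [this]
      refine (measurable_of_finite _).comp (Measurable.prodMk ?_ ?_)
      · exact (measurable_pi_apply _).comp measurable_snd
      · exact measurable_pi_lambda _ fun i => ih _ (by omega)

/-- The measure on a finite set with given weights. -/
noncomputable def weightMeasure {S : Type*} [MeasurableSpace S] [Fintype S] (p : S → ℝ) :
    Measure S :=
  ∑ s, ENNReal.ofReal (p s) • Measure.dirac s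

lemma weightMeasure_singleton {S : Type*} [MeasurableSpace S] [Fintype S]
    [MeasurableSingletonClass S] (p : S → ℝ) (s : S) :
    weightMeasure p {s} = ENNReal.ofReal (p s) := by
  classical
  rw [weightMeasure, Measure.coe_finsetSum, Finset.sum_apply, Finset.sum_eq_single s]
  · simp
  · intro t _ hts
    simp [hts]
  · simp

lemma isProbabilityMeasure_weightMeasure {S : Type*} [MeasurableSpace S] [Fintype S]
    {p : S → ℝ} (h0 : ∀ s, 0 ≤ p s) (h1 : ∑ s, p s = 1) :
    IsProbabilityMeasure (weightMeasure p) := by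
  constructor
  rw [weightMeasure, Measure.coe_finsetSum, Finset.sum_apply]
  simp only [Measure.smul_apply, measure_univ, smul_eq_mul, mul_one]
  rw [← ENNReal.ofReal_sum_of_nonneg fun s _ => h0 s, h1, ENNReal.ofReal_one]

/-- The law of the Markov chain of order `k` with initial weights `p` and transition
probabilities `Q`. -/
lemma exists_markov_law [Fintype A] {k : ℕ} (p : (Fin k → A) → ℝ) (Q : (Fin k → A) → A → ℝ)
    (hp0 : ∀ s, 0 ≤ p s) (hp1 : ∑ s, p s = 1) (hQ0 : ∀ s a, 0 ≤ Q s a)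
    (hQ1 : ∀ s, ∑ a, Q s a = 1) :
    ∃ ν : Measure (ℕ → A), IsProbabilityMeasure ν ∧ ∀ ω m, ν.real (PiNat.cylinder ω (k + m)) =
      p (firstWord k ω) * ∏ j ∈ Finset.range m, Q (firstWord k (shift^[j] ω)) (ω (j + k)) := by
  have := isProbabilityMeasure_weightMeasure hp0 hp1
  have := fun s => isProbabilityMeasure_weightMeasure (hQ0 s) (hQ1 s)
  -- Random maps representation of the chain: an initial word and, independently for each time, a
  -- map whose value at `s` has law `Q s`.
  set P : Measure ((Fin k → A) × (ℕ → (Fin k → A) → A)) :=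
    (weightMeasure p).prod (Measure.infinitePi fun _ : ℕ =>
      Measure.pi fun s => weightMeasure (Q s)) with hP
  refine ⟨P.map fun x => recursivePath x.1 x.2,
    Measure.isProbabilityMeasure_map (measurable_recursivePath k).aemeasurable, fun ω m => ?_⟩
  rw [measureReal_def, Measure.map_apply (measurable_recursivePath k) (measurableSet_cylinder _ _)]
  have hpre : (fun x : (Fin k → A) × (ℕ → (Fin k → A) → A) => recursivePath x.1 x.2) ⁻¹'
      PiNat.cylinder ω (k + m) = {firstWord k ω} ×ˢ (Set.pi (Finset.range m)
        fun j => {h | h (firstWord k (shift^[j] ω)) = ω (j + k)}) := by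
    ext ⟨s, g⟩
    simp [recursivePath_mem_cylinder_iff, -PiNat.mem_cylinder_iff]
  rw [hpre, hP, Measure.prod_prod, weightMeasure_singleton, Measure.infinitePi_pi _
    fun _ _ => MeasurableSet.of_discrete]
  have hpi : ∀ s a, Measure.pi (fun s => weightMeasure (Q s)) {h : (Fin k → A) → A | h s = a} =
      ENNReal.ofReal (Q s a) := by
    intro s a
    rw [← weightMeasure_singleton]
    exact (measurePreserving_eval (fun s => weightMeasure (Q s)) s).measure_preimage (s := {a})
      MeasurableSet.of_discrete.nullMeasurableSet
  simp only [hpi]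
  rw [ENNReal.toReal_mul, ENNReal.toReal_ofReal (hp0 _), ENNReal.toReal_prod]
  simp only [ENNReal.toReal_ofReal (hQ0 _ _)]

end RelativeDimension

/-! ### Ergodicity of irreducible stationary Markov measures. -/

namespace RelativeDimension

variable {A : Type*}

lemma init_firstWord (ω : ℕ → A) (k : ℕ) : Fin.init (firstWord (k + 1) ω) = firstWord k ω := rfl

lemma tail_firstWord (ω : ℕ → A) (k : ℕ) :
    Fin.tail (firstWord (k + 1) ω) = firstWord k (shift ω) := rfl

lemma firstWord_prepend (ω : ℕ → A) (a : A) (k : ℕ) :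
    firstWord (k + 1) (prepend a ω) = Fin.cons a (firstWord k ω) := by
  ext i
  refine Fin.cases rfl (fun i => rfl) i

lemma prepend_mem_cylinder_iff {ω τ : ℕ → A} {n : ℕ} : prepend (ω 0) τ ∈ PiNat.cylinder ω (n + 1) ↔
    τ ∈ PiNat.cylinder (shift ω) n := by
  rw [mem_cylinder_succ_iff, prepend_zero, shift_prepend, eq_self_iff_true, true_and]

variable [MeasurableSpace A]

/-- A measure whose cylinders are given by the products of a Markov chain of order `k`. -/
def HasMarkovProduct (k : ℕ) (ν : Measure (ℕ → A)) (Q : (Fin k → A) → A → ℝ) : Prop :=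
  ∀ ω m, ν.real (PiNat.cylinder ω (k + m)) =
    ν.real (PiNat.cylinder ω k) *
      ∏ j ∈ Finset.range m, Q (firstWord k (shift^[j] ω)) (ω (j + k))

variable {k : ℕ} {ν : Measure (ℕ → A)} {Q : (Fin k → A) → A → ℝ}

lemma HasMarkovProduct.succ (h : HasMarkovProduct k ν Q) (ω : ℕ → A) :
    ν.real (PiNat.cylinder ω (k + 1)) =
      ν.real (PiNat.cylinder ω k) * Q (firstWord k ω) (ω k) := by
  simpa using h ω 1

/-- All factors but the first agree for `ω` and `shift ω`, so the ratio of the two cylinders does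
not depend on `m`. The form without division allows null words. -/
lemma HasMarkovProduct.mul_eq (h : HasMarkovProduct k ν Q) (ω : ℕ → A) (m : ℕ) :
    ν.real (PiNat.cylinder (shift ω) k) * ν.real (PiNat.cylinder ω (k + m + 1)) =
      ν.real (PiNat.cylinder ω (k + 1)) * ν.real (PiNat.cylinder (shift ω) (k + m)) := by
  rw [add_assoc, h ω (m + 1), h.succ ω, h (shift ω) m, Finset.prod_range_succ']
  have h1 : ∀ j, ω (j + 1 + k) = shift ω (j + k) := fun j => by
    rw [shift]; congr 1; omega
  simp only [h1, Function.iterate_succ_apply, Function.iterate_zero, id, zero_add]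
  ring

variable [Finite A] [DiscreteMeasurableSpace A]

lemma measure_cylinder_shift_pos {μ : Measure (ℕ → A)} (hμ : MeasurePreserving shift μ μ)
    {ω : ℕ → A} {k : ℕ} (h : 0 < μ (PiNat.cylinder ω (k + 1))) :
    0 < μ (PiNat.cylinder (shift ω) k) := by
  rw [← hμ.measure_preimage (measurableSet_cylinder _ _).nullMeasurableSet]
  exact h.trans_le (measure_mono fun τ hτ => (mem_cylinder_succ_iff.1 hτ).2)

/-- Irreducibility of the Markov chains that are supported by an ergodic measure. -/
lemma forall_firstWord_mem_of_closed {μ : Measure (ℕ → A)} [IsFiniteMeasure μ]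
    (hμ : Ergodic shift μ) {k : ℕ} (T : Set (Fin k → A))
    (hT : ∀ ω, 0 < μ (PiNat.cylinder ω (k + 1)) → firstWord k ω ∈ T → firstWord k (shift ω) ∈ T)
    (hne : ∃ ω, 0 < μ (PiNat.cylinder ω k) ∧ firstWord k ω ∈ T) (ω : ℕ → A)
    (hω : 0 < μ (PiNat.cylinder ω k)) : firstWord k ω ∈ T := by
  have hE : MeasurableSet (firstWord k ⁻¹' T) := measurable_firstWord k MeasurableSet.of_discrete
  -- A set of words closed under transitions gives a set almost contained in its preimage, hence of
  -- measure zero or full.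
  have hle : (firstWord k ⁻¹' T : Set (ℕ → A)) ≤ᵐ[μ] shift ⁻¹' (firstWord k ⁻¹' T) := by
    filter_upwards [ae_measure_cylinder_pos μ] with τ hτ h
    exact hT τ (hτ _) h
  rcases hμ.ae_empty_or_univ_of_ae_le_preimage hE.nullMeasurableSet hle with h | h
  · obtain ⟨τ, hτ, hτT⟩ := hne
    refine absurd (ae_eq_empty.1 h) (hτ.trans_le (measure_mono fun x hx => ?_)).ne'
    rw [mem_preimage]
    convert hτT using 1
    ext i; exact hx i i.2
  · by_contra hcon
    rw [eventuallyEq_univ, mem_ae_iff] at h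
    refine absurd h (hω.trans_le (measure_mono fun x hx => ?_)).ne'
    rw [mem_compl_iff, mem_preimage]
    convert hcon using 2
    ext i; exact hx i i.2

variable [IsFiniteMeasure ν]

/-- The Markov property: given the cylinder `[ω_1 … ω_k]`, the future is independent of `ω_0`. -/
lemma HasMarkovProduct.measure_smul_map_eq (h : HasMarkovProduct k ν Q) (ω : ℕ → A) :
    ν (PiNat.cylinder (shift ω) k) • (ν.restrict (PiNat.cylinder ω (k + 1))).map shift =
      ν (PiNat.cylinder ω (k + 1)) • ν.restrict (PiNat.cylinder (shift ω) k) := by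
  have := Measure.smul_finite (ν.restrict (PiNat.cylinder (shift ω) k))
    (measure_ne_top ν (PiNat.cylinder ω (k + 1)))
  symm
  refine ext_of_cylinder k fun τ n hn => ?_
  obtain ⟨m, rfl⟩ := Nat.exists_eq_add_of_le hn
  rw [Measure.smul_apply, Measure.smul_apply, smul_eq_mul, smul_eq_mul,
    Measure.map_apply measurable_shift (measurableSet_cylinder _ _),
    Measure.restrict_apply (measurableSet_cylinder _ _),
    Measure.restrict_apply (measurable_shift (measurableSet_cylinder _ _))]
  by_cases hτ : τ ∈ PiNat.cylinder (shift ω) k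
  · have h1 : PiNat.cylinder (shift ω) k = PiNat.cylinder τ k :=
      (PiNat.mem_cylinder_iff_eq.1 hτ).symm
    have h2 : PiNat.cylinder ω (k + 1) = PiNat.cylinder (prepend (ω 0) τ) (k + 1) :=
      (PiNat.mem_cylinder_iff_eq.1 (prepend_mem_cylinder_iff.2 hτ)).symm
    have h3 : PiNat.cylinder τ (k + m) ∩ PiNat.cylinder τ k = PiNat.cylinder τ (k + m) :=
      inter_eq_left.2 (PiNat.cylinder_anti _ (by omega))
    have h4 : shift ⁻¹' PiNat.cylinder τ (k + m) ∩ PiNat.cylinder (prepend (ω 0) τ) (k + 1) =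
        PiNat.cylinder (prepend (ω 0) τ) (k + m + 1) := by
      ext x
      rw [mem_inter_iff, mem_cylinder_succ_iff, mem_cylinder_succ_iff, mem_preimage]
      simp only [shift_prepend]
      exact ⟨fun hx => ⟨hx.2.1, hx.1⟩, fun hx =>
        ⟨hx.2, hx.1, PiNat.cylinder_anti _ (Nat.le_add_right k m) hx.2⟩⟩
    rw [h1, h2, h3, h4]
    have := h.mul_eq (prepend (ω 0) τ) m
    simp only [measureReal_def, ← ENNReal.toReal_mul, shift_prepend] at this
    exact ((ENNReal.toReal_eq_toReal_iff' (ENNReal.mul_ne_top (measure_ne_top _ _)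
      (measure_ne_top _ _)) (ENNReal.mul_ne_top (measure_ne_top _ _)
      (measure_ne_top _ _))).1 this).symm
  · have hdisj : Disjoint (PiNat.cylinder τ (k + m)) (PiNat.cylinder (shift ω) k) := by
      refine disjoint_left.2 fun x hx hx' => hτ fun i hi => ?_
      rw [← hx' i hi, hx i (by omega)]
    rw [hdisj.inter_eq, measure_empty, mul_zero]
    have hdisj' : Disjoint (shift ⁻¹' PiNat.cylinder τ (k + m)) (PiNat.cylinder ω (k + 1)) :=
      disjoint_left.2 fun x hx hx' => disjoint_left.1 hdisj hx (mem_cylinder_succ_iff.1 hx').2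
    rw [hdisj'.inter_eq, measure_empty, mul_zero]

/-- An invariant set depends only on the future, so by the Markov property its conditional
probability does not change when `ω_0` is forgotten. -/
lemma HasMarkovProduct.mul_inter_eq (h : HasMarkovProduct k ν Q) {B : Set (ℕ → A)}
    (hB : MeasurableSet B) (hinv : shift ⁻¹' B = B) (ω : ℕ → A) (m : ℕ) :
    ν (PiNat.cylinder (shift ω) k) * ν (B ∩ PiNat.cylinder ω (k + m + 1)) =
      ν (PiNat.cylinder ω (k + 1)) * ν (B ∩ PiNat.cylinder (shift ω) (k + m)) := by
  have key := congrArg (fun κ : Measure (ℕ → A) => κ (B ∩ PiNat.cylinder (shift ω) (k + m)))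
    (h.measure_smul_map_eq ω)
  have hm : MeasurableSet (B ∩ PiNat.cylinder (shift ω) (k + m)) :=
    hB.inter (measurableSet_cylinder _ _)
  simp only [Measure.smul_apply, smul_eq_mul] at key
  rw [Measure.map_apply measurable_shift hm, Measure.restrict_apply hm,
    Measure.restrict_apply (measurable_shift hm)] at key
  have h1 : B ∩ PiNat.cylinder (shift ω) (k + m) ∩ PiNat.cylinder (shift ω) k =
      B ∩ PiNat.cylinder (shift ω) (k + m) :=
    inter_eq_left.2 (inter_subset_right.trans (PiNat.cylinder_anti _ (by omega)))
  have h2 : shift ⁻¹' (B ∩ PiNat.cylinder (shift ω) (k + m)) ∩ PiNat.cylinder ω (k + 1) =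
      B ∩ PiNat.cylinder ω (k + m + 1) := by
    rw [preimage_inter, hinv]
    ext x
    simp only [mem_inter_iff, mem_preimage, mem_cylinder_succ_iff]
    exact ⟨fun hx => ⟨hx.1.1, hx.2.1, hx.1.2⟩, fun hx =>
      ⟨⟨hx.1, hx.2.2⟩, hx.2.1, PiNat.cylinder_anti _ (Nat.le_add_right k m) hx.2.2⟩⟩
  rwa [h1, h2] at key

/-- An irreducible stationary Markov measure is ergodic. -/
lemma HasMarkovProduct.ergodic (h : HasMarkovProduct k ν Q) (hν : MeasurePreserving shift ν ν)
    (hirr : ∀ T : Set (Fin k → A),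
      (∀ ω, 0 < ν (PiNat.cylinder ω (k + 1)) → firstWord k ω ∈ T → firstWord k (shift ω) ∈ T) →
      (∃ ω, 0 < ν (PiNat.cylinder ω k) ∧ firstWord k ω ∈ T) →
      ∀ ω, 0 < ν (PiNat.cylinder ω k) → firstWord k ω ∈ T) :
    Ergodic shift ν := by
  cases nonempty_fintype A
  refine ⟨hν, ⟨fun B hB hinv => ?_⟩⟩
  rw [eventuallyConst_set']
  by_cases hzero : ∀ ω, ν (PiNat.cylinder ω k) = 0
  · have h0 : ν = 0 := ext_of_cylinder k fun ω n hn => by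
      simpa using measure_mono_null (PiNat.cylinder_anti ω hn) (hzero ω)
    simp [h0, ae_zero, EventuallyEq]
  push Not at hzero
  obtain ⟨ω₀, hω₀⟩ := hzero
  -- The conditional probability of `B` given the first `k` letters. It is harmonic for the chain,
  -- and the maximum principle will show that it is constant on the support.
  set F : (Fin k → A) → ENNReal := fun s => ν (B ∩ wordCylinder s) / ν (wordCylinder s) with hF
  obtain ⟨s₀, hs₀, hmax⟩ :=
    (Set.toFinite {s : Fin k → A | 0 < ν (wordCylinder s)}).exists_maximalFor F _ ⟨firstWord k ω₀,
      by rw [mem_ofPred_eq, ← cylinder_eq_wordCylinder]; exact pos_iff_ne_zero.2 hω₀⟩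
  have hmax' : ∀ s, 0 < ν (wordCylinder s) → F s ≤ F s₀ := by
    intro s hs
    rcases le_total (F s) (F s₀) with h | h
    · exact h
    · exact hmax hs h
  set c := F s₀ with hc
  have hcle : c ≤ 1 := ENNReal.div_le_of_le_mul
    (by rw [one_mul]; exact measure_mono inter_subset_right)
  have hctop : c ≠ ⊤ := ne_top_of_le_ne_top ENNReal.one_ne_top hcle
  have hFω : ∀ ω, 0 < ν (PiNat.cylinder ω k) →
      ν (B ∩ PiNat.cylinder ω k) = F (firstWord k ω) * ν (PiNat.cylinder ω k) := by
    intro ω hω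
    rw [hF]
    simp only [cylinder_eq_wordCylinder] at hω ⊢
    rw [ENNReal.div_mul_cancel hω.ne' (measure_ne_top _ _)]
  have hnext : ∀ ω, 0 < ν (PiNat.cylinder ω (k + 1)) → ν (B ∩ PiNat.cylinder ω (k + 1)) =
      F (firstWord k (shift ω)) * ν (PiNat.cylinder ω (k + 1)) := by
    intro ω hω
    have h1 := measure_cylinder_shift_pos hν hω
    have h2 := h.mul_inter_eq hB hinv ω 0
    rw [add_zero, hFω _ h1] at h2
    have h3 : ν (PiNat.cylinder (shift ω) k) * ν (B ∩ PiNat.cylinder ω (k + 1)) =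
        ν (PiNat.cylinder (shift ω) k) *
          (F (firstWord k (shift ω)) * ν (PiNat.cylinder ω (k + 1))) := by
      rw [h2]; ring
    exact (ENNReal.mul_right_inj h1.ne' (measure_ne_top _ _)).1 h3
  have hupd : ∀ (ω : ℕ → A) a, PiNat.cylinder ω k ∩ {τ | τ k = a} =
      PiNat.cylinder (Function.update ω k a) (k + 1) := by
    intro ω a
    ext τ
    simp only [mem_inter_iff, PiNat.mem_cylinder_iff, mem_ofPred_eq]
    constructor
    · rintro ⟨h1, h2⟩ i hi
      rcases Nat.lt_succ_iff_lt_or_eq.1 hi with h | h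
      · rw [Function.update_of_ne h.ne, h1 i h]
      · rw [h, Function.update_self, h2]
    · intro h1
      refine ⟨fun i hi => ?_, ?_⟩
      · rw [h1 i (by omega), Function.update_of_ne hi.ne]
      · rw [h1 k (by omega), Function.update_self]
  have hle : ∀ ω, ν (B ∩ PiNat.cylinder ω (k + 1)) ≤ c * ν (PiNat.cylinder ω (k + 1)) := by
    intro ω
    rcases eq_zero_or_pos (ν (PiNat.cylinder ω (k + 1))) with h0 | h0
    · rw [measure_mono_null inter_subset_right h0]; exact zero_le
    · rw [hnext ω h0]
      refine mul_le_mul_left (hmax' _ ?_) _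
      rw [← cylinder_eq_wordCylinder]
      exact measure_cylinder_shift_pos hν h0
  have hconst : ∀ ω, 0 < ν (PiNat.cylinder ω k) → F (firstWord k ω) = c := by
    refine hirr {s | F s = c} (fun ω hω hFc => ?_) ?_
    · simp only [mem_ofPred_eq] at hFc ⊢
      have hpos : 0 < ν (PiNat.cylinder ω k) :=
        hω.trans_le (measure_mono (PiNat.cylinder_anti _ (by omega)))
      have h1 := hFω ω hpos
      have e1 : ν (B ∩ PiNat.cylinder ω k) =
          ∑ a, ν (B ∩ PiNat.cylinder (Function.update ω k a) (k + 1)) := by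
        have := measure_cylinder_eq_sum (ν.restrict B) ω k
        simp only [hupd, Measure.restrict_apply (measurableSet_cylinder _ _)] at this
        simpa only [inter_comm B] using this
      have e2 : ν (PiNat.cylinder ω k) =
          ∑ a, ν (PiNat.cylinder (Function.update ω k a) (k + 1)) := by
        simpa only [hupd] using measure_cylinder_eq_sum ν ω k
      classical
      rw [hFc, e1, e2, ← Finset.add_sum_erase _ _ (Finset.mem_univ (ω k)),
        ← Finset.add_sum_erase _ _ (Finset.mem_univ (ω k)), Function.update_eq_self, mul_add,
        Finset.mul_sum] at h1
      -- At a word where `F = c`, the average over successors equals the maximum `c`; cancelling the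
      -- other successors, each at most `c`, forces equality at this one.
      have h2 : c * ν (PiNat.cylinder ω (k + 1)) ≤ ν (B ∩ PiNat.cylinder ω (k + 1)) := by
        have hfin : ∑ a ∈ Finset.univ.erase (ω k),
            c * ν (PiNat.cylinder (Function.update ω k a) (k + 1)) ≠ ⊤ :=
          ENNReal.sum_ne_top.2 fun a _ => ENNReal.mul_ne_top hctop (measure_ne_top _ _)
        refine (ENNReal.add_le_add_iff_right hfin).1 (h1.symm.le.trans ?_)
        gcongr
        exact hle _
      have h3 := le_antisymm (hle ω) h2
      rw [hnext ω hω] at h3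
      exact (ENNReal.mul_left_inj hω.ne' (measure_ne_top _ _)).1 h3
    · have : Nonempty A := ⟨ω₀ 0⟩
      obtain ⟨ω, hω⟩ := exists_firstWord_eq s₀
      refine ⟨ω, ?_, by rw [hω]; rfl⟩
      rw [cylinder_eq_wordCylinder, hω]
      exact hs₀
  have hall : ∀ m ω, ν (B ∩ PiNat.cylinder ω (k + m)) = c * ν (PiNat.cylinder ω (k + m)) := by
    intro m
    induction m with
    | zero =>
      intro ω
      rcases eq_zero_or_pos (ν (PiNat.cylinder ω k)) with h0 | h0
      · rw [add_zero, h0, measure_mono_null inter_subset_right h0, mul_zero]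
      · rw [add_zero, hFω ω h0, hconst ω h0]
    | succ m ih =>
      intro ω
      rw [← add_assoc]
      rcases eq_zero_or_pos (ν (PiNat.cylinder (shift ω) k)) with h0 | h0
      · have h1 : ν (PiNat.cylinder ω (k + m + 1)) = 0 := by
          rw [← hν.measure_preimage (measurableSet_cylinder _ _).nullMeasurableSet] at h0
          refine measure_mono_null (fun τ hτ => ?_) h0
          exact PiNat.cylinder_anti _ (Nat.le_add_right k m) (mem_cylinder_succ_iff.1 hτ).2
        rw [h1, measure_mono_null inter_subset_right h1, mul_zero]
      · have h1 := h.mul_inter_eq hB hinv ω m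
        have h2 := h.mul_inter_eq MeasurableSet.univ preimage_univ ω m
        rw [univ_inter, univ_inter] at h2
        rw [ih, mul_left_comm, ← h2, mul_left_comm] at h1
        exact (ENNReal.mul_right_inj h0.ne' (measure_ne_top _ _)).1 h1
  -- Thus `B` is independent of all cylinders; evaluating at `Bᶜ` gives `c ν(Bᶜ) = 0`.
  have hres : ν.restrict B = c • ν := by
    refine ext_of_cylinder k fun ω n hn => ?_
    obtain ⟨m, rfl⟩ := Nat.exists_eq_add_of_le hn
    rw [Measure.restrict_apply (measurableSet_cylinder _ _), inter_comm, hall m ω]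
    rfl
  have hcompl := congrArg (fun κ : Measure (ℕ → A) => κ Bᶜ) hres
  simp only [Measure.restrict_apply hB.compl, compl_inter_self, measure_empty,
    Measure.smul_apply, smul_eq_mul] at hcompl
  rcases mul_eq_zero.1 hcompl.symm with h0 | h0
  · left
    rw [ae_eq_empty, ← Measure.restrict_apply_self, hres, h0]
    simp
  · right
    rwa [eventuallyEq_univ, mem_ae_iff]

end RelativeDimension

/-! ### Ergodic rational Markov measures with the support of a given ergodic measure. -/

namespace RelativeDimension

variable {A : Type*}

lemma sum_word_eq_sum_snoc [Fintype A] {k : ℕ} (f : (Fin (k + 1) → A) → ℝ) :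
    ∑ u, f u = ∑ s : Fin k → A, ∑ a, f (Fin.snoc s a) := by
  rw [← (Fin.snocEquiv fun _ : Fin (k + 1) => A).sum_comp, Fintype.sum_prod_type,
    Finset.sum_comm]
  rfl

lemma sum_word_eq_sum_cons [Fintype A] {k : ℕ} (f : (Fin (k + 1) → A) → ℝ) :
    ∑ u, f u = ∑ a, ∑ s : Fin k → A, f (Fin.cons a s) := by
  rw [← (Fin.consEquiv fun _ : Fin (k + 1) => A).sum_comp, Fintype.sum_prod_type]
  rfl

variable [MeasurableSpace A]

/-- The transition matrix on words of length `k` of a Markov chain of order `k`. -/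
noncomputable def wordMatrix [Fintype A] [DecidableEq A] {k : ℕ} (Q : (Fin k → A) → A → ℝ)
    (s t : Fin k → A) : ℝ :=
  ∑ u : Fin (k + 1) → A, if Fin.init u = s ∧ Fin.tail u = t then Q (Fin.init u) (u (Fin.last k))
    else 0

section wordMatrix

variable [Fintype A] [DecidableEq A] {k : ℕ} {Q : (Fin k → A) → A → ℝ}

lemma sum_wordMatrix (s : Fin k → A) : ∑ t, wordMatrix Q s t = ∑ a, Q s a := by
  simp only [wordMatrix]
  rw [Finset.sum_comm, sum_word_eq_sum_snoc]
  simp only [Fin.init_snoc, Fin.snoc_last, ite_and]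
  rw [Finset.sum_eq_single s]
  · simp
  · intro t _ hts; simp [hts]
  · simp

/-- This turns stationarity of `v` into a sum over the letter put in front of `ω`, the form needed
for shift-invariance on cylinders. -/
lemma sum_mul_wordMatrix (v : (Fin k → A) → ℝ) (ω : ℕ → A) :
    ∑ s, v s * wordMatrix Q s (firstWord k ω) = ∑ a, v (firstWord k (prepend a ω)) *
      Q (firstWord k (prepend a ω)) (prepend a ω k) := by
  simp only [wordMatrix, Finset.mul_sum]
  rw [Finset.sum_comm, sum_word_eq_sum_cons]
  refine Finset.sum_congr rfl fun a _ => ?_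
  rw [Finset.sum_eq_single (firstWord k ω)]
  · rw [← firstWord_prepend, init_firstWord, Finset.sum_eq_single (firstWord k (prepend a ω))]
    · rw [if_pos ⟨rfl, by rw [tail_firstWord, shift_prepend]⟩]
      rfl
    · intro s _ hs
      rw [if_neg fun h => hs h.1.symm, mul_zero]
    · simp
  · intro s _ hs
    refine Finset.sum_eq_zero fun t _ => ?_
    rw [if_neg fun h => hs h.2, mul_zero]
  · simp

end wordMatrix

variable [Finite A] [DiscreteMeasurableSpace A]

lemma measureReal_cylinder_pos_iff {μ : Measure (ℕ → A)} [IsFiniteMeasure μ] {ω : ℕ → A} {n : ℕ} :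
    0 < μ.real (PiNat.cylinder ω n) ↔ 0 < μ (PiNat.cylinder ω n) := by
  rw [measureReal_def, ENNReal.toReal_pos_iff]
  simp [measure_lt_top]

lemma sum_measureReal_wordCylinder_snoc [Fintype A] (μ : Measure (ℕ → A)) [IsFiniteMeasure μ]
    {k : ℕ} (s : Fin k → A) :
    ∑ a, μ.real (wordCylinder (Fin.snoc s a : Fin (k + 1) → A)) = μ.real (wordCylinder s) := by
  rcases isEmpty_or_nonempty A with hA | hA
  · have : IsEmpty (ℕ → A) := ⟨fun ω => hA.false (ω 0)⟩
    simp [eq_empty_of_isEmpty]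
  obtain ⟨ω, rfl⟩ := exists_firstWord_eq s
  have h := measure_cylinder_eq_sum μ ω k
  have h1 : ∀ a, PiNat.cylinder ω k ∩ {τ | τ k = a} =
      wordCylinder (Fin.snoc (firstWord k ω) a : Fin (k + 1) → A) := by
    intro a
    ext τ
    simp only [wordCylinder, Fin.forall_fin_succ', mem_inter_iff, mem_ofPred_eq, Fin.snoc_castSucc,
      Fin.snoc_last, PiNat.mem_cylinder_iff, Fin.forall_iff, firstWord]
    rfl
  simp only [h1] at h
  rw [measureReal_def, ← cylinder_eq_wordCylinder, h,
    ENNReal.toReal_sum fun a _ => measure_ne_top _ _]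
  rfl

/-- Rational transition probabilities that are close to those of `μ`. -/
lemma exists_rat_transition [Nonempty A] [Fintype A] (μ : Measure (ℕ → A)) [IsFiniteMeasure μ]
    (k : ℕ) {δ : ℝ} (hδ : 0 < δ) : ∃ q : (Fin k → A) → A → ℚ, (∀ s a, 0 ≤ q s a) ∧
      (∀ s, ∑ a, q s a = 1) ∧ ∀ ω, 0 < μ.real (PiNat.cylinder ω k) →
        (0 < q (firstWord k ω) (ω k) ↔ 0 < μ.real (PiNat.cylinder ω (k + 1))) ∧
        μ.real (PiNat.cylinder ω (k + 1)) / μ.real (PiNat.cylinder ω k) ≤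
          Real.exp δ * q (firstWord k ω) (ω k) := by
  classical
  have hex : ∀ s : Fin k → A, ∃ q : A → ℚ, (∀ a, 0 ≤ q a) ∧ ∑ a, q a = 1 ∧
      (0 < μ.real (wordCylinder s) → ∀ a,
        (0 < q a ↔ 0 < μ.real (wordCylinder (Fin.snoc s a : Fin (k + 1) → A))) ∧
        μ.real (wordCylinder (Fin.snoc s a : Fin (k + 1) → A)) / μ.real (wordCylinder s) ≤
          Real.exp δ * q a) := by
    intro s
    by_cases hs : 0 < μ.real (wordCylinder s)
    · obtain ⟨q, h0, h1, h2, h3⟩ := exists_rat_stochastic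
        (fun a => μ.real (wordCylinder (Fin.snoc s a : Fin (k + 1) → A)) / μ.real (wordCylinder s))
        (fun a => by positivity)
        (by rw [← Finset.sum_div, sum_measureReal_wordCylinder_snoc, div_self hs.ne']) hδ
      exact ⟨q, h0, h1, fun _ a => ⟨by rw [h2, div_pos_iff_of_pos_right hs], h3 a⟩⟩
    -- Null words get an arbitrary point mass, only to keep the table stochastic everywhere.
    · refine ⟨Pi.single (Classical.arbitrary A) 1, fun a => ?_, by simp, fun h => absurd h hs⟩
      exact (Pi.single_nonneg (α := fun _ => ℚ)).2 zero_le_one a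
  choose q h0 h1 h2 using hex
  refine ⟨q, h0, h1, fun ω hω => ?_⟩
  have hsnoc : (Fin.snoc (firstWord k ω) (ω k) : Fin (k + 1) → A) = firstWord (k + 1) ω :=
    Fin.snoc_init_self (firstWord (k + 1) ω)
  rw [cylinder_eq_wordCylinder] at hω
  rw [cylinder_eq_wordCylinder, cylinder_eq_wordCylinder, ← hsnoc]
  exact h2 _ hω (ω k)

lemma measureReal_cylinder_shift_pos {μ : Measure (ℕ → A)} [IsFiniteMeasure μ]
    (hμ : MeasurePreserving shift μ μ) {ω : ℕ → A} {k : ℕ}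
    (h : 0 < μ.real (PiNat.cylinder ω (k + 1))) : 0 < μ.real (PiNat.cylinder (shift ω) k) := by
  rw [measureReal_cylinder_pos_iff] at h ⊢
  exact measure_cylinder_shift_pos hμ h

/-- A stationary Markov measure with given transition probabilities on the support of an ergodic
measure. -/
lemma exists_stationary_markov [Fintype A] {μ : Measure (ℕ → A)} [IsProbabilityMeasure μ]
    (hμ : Ergodic shift μ) {k : ℕ} (Q : (Fin k → A) → A → ℝ) (hQ0 : ∀ s a, 0 ≤ Q s a)
    (hQ1 : ∀ s, ∑ a, Q s a = 1)
    (hQ : ∀ ω, 0 < μ.real (PiNat.cylinder ω k) →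
      (0 < Q (firstWord k ω) (ω k) ↔ 0 < μ.real (PiNat.cylinder ω (k + 1)))) :
    ∃ ν : Measure (ℕ → A), IsProbabilityMeasure ν ∧ Ergodic shift ν ∧ HasMarkovProduct k ν Q ∧
      ∀ ω, 0 < μ.real (PiNat.cylinder ω k) → 0 < ν.real (PiNat.cylinder ω k) := by
  classical
  have hinv := hμ.toMeasurePreserving
  obtain ⟨ω₀, hω₀⟩ := (ae_measure_cylinder_pos μ).exists
  have : Nonempty A := ⟨ω₀ 0⟩
  -- The words charged by `μ` form a closed set of states, since `Q` allows from them only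
  -- transitions charged by `μ`.
  set X : Set (Fin k → A) := {s | 0 < μ.real (wordCylinder s)} with hX
  have hXω : ∀ ω, firstWord k ω ∈ X ↔ 0 < μ.real (PiNat.cylinder ω k) := fun ω => by
    rw [cylinder_eq_wordCylinder]; rfl
  obtain ⟨v, hv0, hvX, hv1, hv⟩ := exists_stationary_of_closed X
    ⟨firstWord k ω₀, (hXω ω₀).2 (measureReal_cylinder_pos_iff.2 (hω₀ k))⟩ (wordMatrix Q)
    (fun s t => Finset.sum_nonneg fun u _ => by split_ifs; exacts [hQ0 _ _, le_rfl])
    (fun s _ => by rw [sum_wordMatrix, hQ1])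
    (by
      intro s hs t hst
      obtain ⟨u, -, hu⟩ := Finset.exists_ne_zero_of_sum_ne_zero hst
      obtain ⟨ω, rfl⟩ := exists_firstWord_eq u
      have h := (ite_ne_right_iff.1 hu)
      rw [init_firstWord, tail_firstWord] at h
      obtain ⟨⟨rfl, rfl⟩, h⟩ := h
      rw [hXω] at hs ⊢
      exact measureReal_cylinder_shift_pos hinv
        ((hQ ω hs).1 (lt_of_le_of_ne (hQ0 _ _) (Ne.symm h))))
  obtain ⟨ν, hν, hνcyl⟩ := exists_markov_law v Q hv0 hv1 hQ0 hQ1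
  have hνk : ∀ ω, ν.real (PiNat.cylinder ω k) = v (firstWord k ω) := fun ω => by
    simpa using hνcyl ω 0
  have hprod : HasMarkovProduct k ν Q := fun ω m => by rw [hνk, hνcyl]
  have hstat : ∀ ω, ∑ a, v (firstWord k (prepend a ω)) *
      Q (firstWord k (prepend a ω)) (prepend a ω k) = v (firstWord k ω) := fun ω => by
    rw [← sum_mul_wordMatrix, hv]
  have hνinv : MeasurePreserving shift ν ν := by
    refine ⟨measurable_shift, ?_⟩
    symm
    refine ext_of_cylinder k fun ω n hn => ?_
    obtain ⟨m, rfl⟩ := Nat.exists_eq_add_of_le hn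
    rw [Measure.map_apply measurable_shift (measurableSet_cylinder _ _),
      ← sum_measure_cylinder_prepend, tsum_fintype]
    rw [← ENNReal.toReal_eq_toReal_iff' (measure_ne_top _ _)
      (ENNReal.sum_ne_top.2 fun _ _ => measure_ne_top _ _),
      ENNReal.toReal_sum fun _ _ => measure_ne_top _ _]
    have h1 : ∀ a j, prepend a ω (j + 1 + k) = ω (j + k) := fun a j => by
      rw [add_right_comm, prepend_succ]
    simp only [← measureReal_def, add_assoc, hνcyl, Finset.prod_range_succ',
      Function.iterate_succ_apply, shift_prepend, Function.iterate_zero, id]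
    simp only [← add_assoc, h1, zero_add]
    rw [← hstat ω, Finset.sum_mul]
    exact Finset.sum_congr rfl fun a _ => by ring
  have hsupp : ∀ ω, 0 < μ.real (PiNat.cylinder ω k) → 0 < ν.real (PiNat.cylinder ω k) := by
    intro ω hω
    rw [hνk]
    -- The support of a stationary vector is closed under transitions, so ergodicity of `μ` forces
    -- it to be all of `X`.
    refine forall_firstWord_mem_of_closed hμ {s | 0 < v s} (fun τ hτ hvτ => ?_) ?_ ω
      (measureReal_cylinder_pos_iff.1 hω)
    · have hvτ' : 0 < v (firstWord k τ) := hvτ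
      have hτ' := measureReal_cylinder_pos_iff.2 hτ
      have hk := (hXω τ).1 (hvX _ hvτ'.ne')
      have hQτ := (hQ τ hk).2 hτ'
      change 0 < v (firstWord k (shift τ))
      rw [← hstat (shift τ)]
      refine (mul_pos hvτ' hQτ).trans_le ?_
      have := Finset.single_le_sum (f := fun a => v (firstWord k (prepend a (shift τ))) *
        Q (firstWord k (prepend a (shift τ))) (prepend a (shift τ) k))
        (fun a _ => mul_nonneg (hv0 _) (hQ0 _ _)) (Finset.mem_univ (τ 0))
      simpa only [prepend_shift] using this
    · obtain ⟨s, -, hs⟩ := Finset.exists_ne_zero_of_sum_ne_zero (hv1.trans_ne one_ne_zero)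
      obtain ⟨τ, rfl⟩ := exists_firstWord_eq s
      exact ⟨τ, measureReal_cylinder_pos_iff.1 ((hXω τ).1 (hvX _ hs)),
        lt_of_le_of_ne (hv0 _) (Ne.symm hs)⟩
  have hsupp' : ∀ ω, 0 < ν.real (PiNat.cylinder ω k) → 0 < μ.real (PiNat.cylinder ω k) := by
    intro ω hω
    rw [hνk] at hω
    exact (hXω ω).1 (hvX _ hω.ne')
  refine ⟨ν, hν, hprod.ergodic hνinv fun T hT hne ω hω => ?_, hprod, hsupp⟩
  -- As `ν` and `μ` charge the same words and transitions, irreducibility passes from `μ` to `ν`.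
  refine forall_firstWord_mem_of_closed hμ T (fun τ hτ hτT => hT τ ?_ hτT) ?_ ω ?_
  · rw [← measureReal_cylinder_pos_iff, hprod.succ]
    have hk : 0 < μ.real (PiNat.cylinder τ k) := measureReal_cylinder_pos_iff.2
      (hτ.trans_le (measure_mono (PiNat.cylinder_anti _ (by omega))))
    exact mul_pos (hsupp τ hk) ((hQ τ hk).2 (measureReal_cylinder_pos_iff.2 hτ))
  · obtain ⟨τ, hτ, hτT⟩ := hne
    exact ⟨τ, measureReal_cylinder_pos_iff.1 (hsupp' τ (measureReal_cylinder_pos_iff.2 hτ)), hτT⟩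
  · exact measureReal_cylinder_pos_iff.1 (hsupp' ω (measureReal_cylinder_pos_iff.2 hω))

lemma HasMarkovProduct.transition_block_eq {k : ℕ} {ν : Measure (ℕ → A)} [IsFiniteMeasure ν]
    {Q : (Fin k → A) → A → ℝ} (h : HasMarkovProduct k ν Q) (ω : ℕ → A) (j : ℕ)
    (hpos : 0 < ν.real (PiNat.cylinder (shift^[j] ω) k)) :
    transition ν (block ω j k) (ω (j + k)) = Q (firstWord k (shift^[j] ω)) (ω (j + k)) := by
  rw [transition_block, h.succ, mul_div_cancel_left₀ _ hpos.ne', shift_iterate_apply, add_comm k]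

lemma HasMarkovProduct.isMarkov {k : ℕ} {ν : Measure (ℕ → A)} [IsProbabilityMeasure ν]
    {Q : (Fin k → A) → A → ℝ} (h : HasMarkovProduct k ν Q) (hν : MeasurePreserving shift ν ν) :
    IsMarkov k ν where
  prob := inferInstance
  invariant := hν
  markov m ω := by
    rw [cylinder_pre, cylinder_pre]
    -- At a null block `transition` is 0 by convention while `Q` need not be; then both sides
    -- vanish, the left one by invariance.
    by_cases hz : ∃ j < m, ν.real (PiNat.cylinder (shift^[j] ω) k) = 0
    · obtain ⟨j, hj, h0⟩ := hz
      rw [Finset.prod_eq_zero (Finset.mem_range.2 hj) (by rw [transition_block, h0, div_zero]),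
        mul_zero]
      rw [measureReal_eq_zero_iff] at h0 ⊢
      rw [← (hν.iterate j).measure_preimage (measurableSet_cylinder _ _).nullMeasurableSet] at h0
      refine measure_mono_null (fun τ hτ => ?_) h0
      exact shift_mem_cylinder_of_mem (PiNat.cylinder_anti _ (by omega) hτ)
    · push Not at hz
      rw [h]
      congr 1
      refine Finset.prod_congr rfl fun j hj => ?_
      exact (h.transition_block_eq ω j (lt_of_le_of_ne measureReal_nonneg
        (hz j (Finset.mem_range.1 hj)).symm)).symm

lemma HasMarkovProduct.exists_transition_eq_rat [Nonempty A] {k : ℕ} {ν : Measure (ℕ → A)}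
    [IsProbabilityMeasure ν] {q : (Fin k → A) → A → ℚ}
    (h : HasMarkovProduct k ν fun s a => (q s a : ℝ)) (w : List A) (hw : w.length = k) (a : A) :
    ∃ r : ℚ, transition ν w a = (r : ℝ) := by
  obtain ⟨ω, hω⟩ := exists_pre_eq (w ++ [a])
  rw [List.length_append, hw, List.length_singleton, pre_succ] at hω
  obtain ⟨h1, h2⟩ := List.append_inj' hω rfl
  have h3 : ω k = a := by simpa using h2
  have h4 : transition ν w a = transition ν (block ω 0 k) (ω (0 + k)) := by
    rw [zero_add, h3, ← h1]; rfl
  rw [h4]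
  rcases (measureReal_nonneg (μ := ν) (s := PiNat.cylinder (shift^[0] ω) k)).eq_or_lt with h0 | h0
  · exact ⟨0, by rw [transition_block, ← h0, div_zero, Rat.cast_zero]⟩
  · exact ⟨_, h.transition_block_eq ω 0 h0⟩

end RelativeDimension

/-! ### Countability of the witness, and the approximation theorem. -/

namespace RelativeDimension

variable {A : Type*} [MeasurableSpace A]

lemma IsMarkov.cylinder_eq {k : ℕ} {ν : Measure (ℕ → A)} (h : IsMarkov k ν) (ω : ℕ → A) (m : ℕ) :
    ν.real (PiNat.cylinder ω (k + m)) = ν.real (PiNat.cylinder ω k) *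
      ∏ j ∈ Finset.range m, transition ν (block ω j k) (ω (j + k)) := by
  rw [← cylinder_pre, ← cylinder_pre, h.markov]

variable [Finite A] [DiscreteMeasurableSpace A]

/-- By the default value 0, the transition table shows which words of length `k` are charged. -/
lemma exists_transition_ne_zero {ν : Measure (ℕ → A)} [IsFiniteMeasure ν] {ω : ℕ → A} {k : ℕ}
    (h : ν (PiNat.cylinder ω k) ≠ 0) : ∃ a, transition ν (pre ω k) a ≠ 0 := by
  obtain ⟨τ, hτ, hpos⟩ := ((frequently_ae_mem_iff.2 h).and_eventually
    (ae_measure_cylinder_pos ν)).exists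
  have hpre : pre ω k = block τ 0 k := (pre_eq_pre_iff.2 hτ).symm
  refine ⟨τ (0 + k), ?_⟩
  rw [hpre, transition_block]
  exact (div_pos (measureReal_cylinder_pos_iff.2 (hpos _))
    (measureReal_cylinder_pos_iff.2 (hpos _))).ne'

/-- Equal tables give the same null words of length `k`, and on each `k`-cylinder the two measures
are proportional, so the density depends on `k` letters only. -/
lemma IsMarkov.absolutelyContinuous_of_transition_eq {k : ℕ} {ν ν' : Measure (ℕ → A)}
    (h : IsMarkov k ν) (h' : IsMarkov k ν')
    (ht : ∀ w : List A, w.length = k → ∀ a, transition ν w a = transition ν' w a) : ν ≪ ν' := by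
  have := h.prob
  have := h'.prob
  have hsupp : ∀ ω, ν' (PiNat.cylinder ω k) = 0 → ν (PiNat.cylinder ω k) = 0 := by
    intro ω h0
    by_contra hne
    obtain ⟨a, ha⟩ := exists_transition_ne_zero hne
    rw [ht _ (length_pre ω k), transition, cylinder_pre, measureReal_def ν' (PiNat.cylinder ω k),
      h0, ENNReal.toReal_zero, div_zero] at ha
    exact ha rfl
  have hmul : ∀ ω m, ν (PiNat.cylinder ω k) * ν' (PiNat.cylinder ω (k + m)) =
      ν' (PiNat.cylinder ω k) * ν (PiNat.cylinder ω (k + m)) := by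
    intro ω m
    rw [← ENNReal.toReal_eq_toReal_iff' (by finiteness) (by finiteness), ENNReal.toReal_mul,
      ENNReal.toReal_mul]
    simp only [← measureReal_def]
    rw [h.cylinder_eq, h'.cylinder_eq]
    simp only [ht _ (show (block ω _ k).length = k by simp [block])]
    ring
  have heq : ν = ν'.withDensity fun ω => ν (PiNat.cylinder ω k) / ν' (PiNat.cylinder ω k) := by
    refine ext_of_cylinder k fun ω n hn => ?_
    obtain ⟨m, rfl⟩ := Nat.exists_eq_add_of_le hn
    rw [withDensity_apply _ (measurableSet_cylinder _ _),
      setLIntegral_congr_fun (g := fun _ => ν (PiNat.cylinder ω k) / ν' (PiNat.cylinder ω k))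
        (measurableSet_cylinder _ _) fun τ hτ => ?_, setLIntegral_const]
    · rcases eq_or_ne (ν' (PiNat.cylinder ω k)) 0 with h0 | h0
      · rw [hsupp ω h0, ENNReal.zero_div, zero_mul]
        exact measure_mono_null (PiNat.cylinder_anti ω hn) (hsupp ω h0)
      · rw [div_eq_mul_inv, mul_right_comm, hmul, mul_comm, ← mul_assoc,
          ENNReal.inv_mul_cancel h0 (measure_ne_top _ _), one_mul]
    · have : PiNat.cylinder τ k = PiNat.cylinder ω k :=
        PiNat.mem_cylinder_iff_eq.1 (PiNat.cylinder_anti ω hn hτ)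
      simp only [this]
  rw [heq]
  exact withDensity_absolutelyContinuous _ _

lemma countable_rationalMarkovMeasures : (rationalMarkovMeasures A).Countable := by
  set S : ℕ → Set (Measure (ℕ → A)) := fun k => {ν | ν ∈ ergodicMeasures A ∧ IsMarkov k ν ∧
    ∀ w : List A, w.length = k → ∀ a : A, ∃ q : ℚ, transition ν w a = (q : ℝ)} with hS
  have hsub : rationalMarkovMeasures A ⊆ ⋃ k, S k := by
    rintro ν ⟨hν, k, -, hk⟩
    exact mem_iUnion.2 ⟨k, hν, hk⟩
  refine Countable.mono hsub (countable_iUnion fun k => ?_)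
  refine countable_of_injective_of_countable_image
    (f := fun ν (s : Fin k → A) a => transition ν (List.ofFn s) a) ?_ ?_
  · rintro ν ⟨⟨hν, herg⟩, hM, -⟩ ν' ⟨⟨hν', herg'⟩, hM', -⟩ heq
    -- An invariant probability measure absolutely continuous with respect to an ergodic one equals
    -- it, so the table determines the measure.
    refine herg'.eq_of_absolutelyContinuous herg.toMeasurePreserving ?_
    refine hM.absolutelyContinuous_of_transition_eq hM' fun w hw a => ?_
    subst hw
    have := congrFun (congrFun heq w.get) a
    simpa only [List.ofFn_get] using this
  · refine (countable_range fun (q : (Fin k → A) → A → ℚ) s a => (q s a : ℝ)).mono ?_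
    rintro _ ⟨ν, ⟨-, -, hq⟩, rfl⟩
    choose q hq using hq
    exact ⟨fun s a => q (List.ofFn s) (by simp) a, by ext s a; exact (hq _ _ a).symm⟩

/-- The product of forward transition probabilities, rewritten with backward ones. -/
lemma prod_transition_eq_prod_pastQuotient (μ : Measure (ℕ → A)) {ω : ℕ → A}
    (hpos : ∀ j n, 0 < μ.real (PiNat.cylinder (shift^[j] ω) n)) (k m : ℕ) :
    μ.real (PiNat.cylinder ω k) * ∏ j ∈ Finset.range m,
        (μ.real (PiNat.cylinder (shift^[j] ω) (k + 1)) / μ.real (PiNat.cylinder (shift^[j] ω) k)) =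
      (∏ j ∈ Finset.range m, pastQuotient μ k (shift^[j] ω)) *
        μ.real (PiNat.cylinder (shift^[m] ω) k) := by
  induction m with
  | zero => simp
  | succ m ih =>
    rw [Finset.prod_range_succ, Finset.prod_range_succ, ← mul_assoc, ih, pastQuotient,
      ← Function.iterate_succ_apply' shift]
    have h1 := (hpos m k).ne'
    have h2 := (hpos (m + 1) k).ne'
    field_simp

lemma exists_pos_le_measureReal_cylinder (μ : Measure (ℕ → A)) (k : ℕ) :
    ∃ c : ℝ, 0 < c ∧ ∀ ω, 0 < μ.real (PiNat.cylinder ω k) → c ≤ μ.real (PiNat.cylinder ω k) := by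
  rcases (Set.toFinite {s : Fin k → A | 0 < μ.real (wordCylinder s)}).exists_minimalFor
      (fun s => μ.real (wordCylinder s)) _ with h
  by_cases hne : {s : Fin k → A | 0 < μ.real (wordCylinder s)}.Nonempty
  · obtain ⟨s, hs, hmin⟩ := h hne
    refine ⟨_, hs, fun ω hω => ?_⟩
    rw [cylinder_eq_wordCylinder] at hω ⊢
    rcases le_total (μ.real (wordCylinder s)) (μ.real (wordCylinder (firstWord k ω))) with h | h
    · exact h
    · exact hmin hω h
  · refine ⟨1, one_pos, fun ω hω => absurd ⟨firstWord k ω, ?_⟩ hne⟩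
    rwa [cylinder_eq_wordCylinder] at hω

/-- The half of the comparison that requires no relation between the two measures. -/
lemma ae_eventually_cylinder_le_exp_mul (μ ν : Measure (ℕ → A)) [IsProbabilityMeasure μ]
    [IsProbabilityMeasure ν] {δ : ℝ} (hδ : 0 < δ) : ∀ᵐ ω ∂μ, ∀ᶠ n : ℕ in atTop,
      ν.real (PiNat.cylinder ω n) ≤ Real.exp (δ * n) * μ.real (PiNat.cylinder ω n) := by
  have h := ae_eventually_le_exp_of_lintegral_le (μ := μ)
    (X := fun n ω => ν (PiNat.cylinder ω n) / μ (PiNat.cylinder ω n))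
    (fun n => (measurable_measure_cylinder ν n).div (measurable_measure_cylinder μ n))
    ENNReal.one_ne_top (fun n => (lintegral_cylinder_div_le ν μ n).trans measure_univ.le) hδ
  filter_upwards [h, ae_measure_cylinder_pos μ] with ω hω hpos
  filter_upwards [hω] with n hn
  have := ENNReal.toReal_mono (ENNReal.mul_ne_top ENNReal.ofReal_ne_top (measure_ne_top _ _))
    ((ENNReal.div_le_iff (hpos n).ne' (measure_ne_top _ _)).1 hn)
  rwa [ENNReal.toReal_mul, ENNReal.toReal_ofReal (Real.exp_pos _).le] at this

/-- Every ergodic measure is approximated, at exponential scale along almost every sequence, by an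
ergodic rational Markov measure. -/
lemma exists_rationalMarkovMeasure_approx {μ : Measure (ℕ → A)} (hμ : μ ∈ ergodicMeasures A)
    {δ : ℝ} (hδ : 0 < δ) : ∃ ν ∈ rationalMarkovMeasures A,
      ∀ᵐ ω ∂μ, ∀ᶠ n in atTop, 0 < μ.real (PiNat.cylinder ω n) ∧
        0 < ν.real (PiNat.cylinder ω n) ∧
        |Real.log (μ.real (PiNat.cylinder ω n) / ν.real (PiNat.cylinder ω n))| ≤ δ * n := by
  cases nonempty_fintype A
  obtain ⟨hprob, hμ⟩ := hμ
  have hinv := hμ.toMeasurePreserving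
  obtain ⟨ω₀, -⟩ := (ae_measure_cylinder_pos μ).exists
  have : Nonempty A := ⟨ω₀ 0⟩
  -- One quarter of `δ` pays for the bound by `pastQuotient`, one for the rational rounding; the
  -- remaining half absorbs the constant `K` below.
  have hδ4 : 0 < δ / 4 := by positivity
  obtain ⟨k, hk, hsmb⟩ := exists_ae_eventually_cylinder_le hμ hδ4
  obtain ⟨q, hq0, hq1, hq⟩ := exists_rat_transition μ k hδ4
  obtain ⟨ν, hν, hνerg, hprod, hsupp⟩ := exists_stationary_markov hμ (fun s a => (q s a : ℝ))
    (fun s a => by exact_mod_cast hq0 s a) (fun s => by exact_mod_cast hq1 s)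
    (fun ω hω => by rw [Rat.cast_pos]; exact (hq ω hω).1)
  refine ⟨ν, ⟨⟨hν, hνerg⟩, k, hk, hprod.isMarkov hνerg.toMeasurePreserving,
    fun w hw a => hprod.exists_transition_eq_rat w hw a⟩, ?_⟩
  obtain ⟨c, hc, hcle⟩ := exists_pos_le_measureReal_cylinder μ k
  filter_upwards [hsmb, ae_measure_cylinder_iterate_pos hinv,
    ae_eventually_cylinder_le_exp_mul μ ν hδ] with ω hω hpos hup
  have hpos' : ∀ j n, 0 < μ.real (PiNat.cylinder (shift^[j] ω) n) := fun j n =>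
    measureReal_cylinder_pos_iff.2 (hpos j n)
  have hν0 : 0 < ν.real (PiNat.cylinder ω k) := hsupp ω (hpos' 0 k)
  -- The boundary terms: the initial mass of `ν`, and the lower bound `c` for the last `k`-block
  -- left over when backward conditional probabilities are turned into forward ones.
  set K := ν.real (PiNat.cylinder ω k) * c with hK
  have hK0 : 0 < K := mul_pos hν0 hc
  have hlow : ∀ m : ℕ, K * ∏ j ∈ Finset.range m, pastQuotient μ k (shift^[j] ω) ≤
      Real.exp (δ / 4 * m) * ν.real (PiNat.cylinder ω (k + m)) := by
    intro m
    set R := ∏ j ∈ Finset.range m, (μ.real (PiNat.cylinder (shift^[j] ω) (k + 1)) /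
      μ.real (PiNat.cylinder (shift^[j] ω) k)) with hR
    have hR0 : 0 ≤ R := Finset.prod_nonneg fun j _ => by positivity
    have hG0 : 0 ≤ ∏ j ∈ Finset.range m, pastQuotient μ k (shift^[j] ω) :=
      Finset.prod_nonneg fun j _ => div_nonneg measureReal_nonneg measureReal_nonneg
    have h1 : c * ∏ j ∈ Finset.range m, pastQuotient μ k (shift^[j] ω) ≤ R := by
      calc c * ∏ j ∈ Finset.range m, pastQuotient μ k (shift^[j] ω)
          ≤ (∏ j ∈ Finset.range m, pastQuotient μ k (shift^[j] ω)) *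
            μ.real (PiNat.cylinder (shift^[m] ω) k) := by
            rw [mul_comm]
            exact mul_le_mul_of_nonneg_left (hcle _ (hpos' m k)) hG0
        _ = μ.real (PiNat.cylinder ω k) * R :=
            (prod_transition_eq_prod_pastQuotient μ hpos' k m).symm
        _ ≤ R := mul_le_of_le_one_left hR0 measureReal_le_one
    have h2 : R ≤ Real.exp (δ / 4 * m) *
        ∏ j ∈ Finset.range m, (q (firstWord k (shift^[j] ω)) (ω (j + k)) : ℝ) := by
      have := Finset.prod_le_prod (s := Finset.range m) (fun j _ => by positivity)
        fun j _ => (hq (shift^[j] ω) (hpos' j k)).2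
      refine this.trans_eq ?_
      rw [Finset.prod_mul_distrib, Finset.prod_const, Finset.card_range, ← Real.exp_nat_mul,
        mul_comm (m : ℝ)]
      simp only [shift_iterate_apply, add_comm k]
    calc K * ∏ j ∈ Finset.range m, pastQuotient μ k (shift^[j] ω)
        = ν.real (PiNat.cylinder ω k) *
            (c * ∏ j ∈ Finset.range m, pastQuotient μ k (shift^[j] ω)) := by rw [hK]; ring
      _ ≤ ν.real (PiNat.cylinder ω k) * (Real.exp (δ / 4 * m) *
            ∏ j ∈ Finset.range m, (q (firstWord k (shift^[j] ω)) (ω (j + k)) : ℝ)) :=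
          mul_le_mul_of_nonneg_left (h1.trans h2) hν0.le
      _ = Real.exp (δ / 4 * m) * ν.real (PiNat.cylinder ω (k + m)) := by
          rw [hprod ω m]; ring
  have hmain : ∀ᶠ n : ℕ in atTop, 0 < ν.real (PiNat.cylinder ω n) ∧
      μ.real (PiNat.cylinder ω n) ≤ Real.exp (δ * n) * ν.real (PiNat.cylinder ω n) := by
    obtain ⟨N, hN⟩ := eventually_atTop.1 hω
    obtain ⟨M, hM⟩ := exists_nat_ge (-Real.log K / (δ / 2))
    refine eventually_atTop.2 ⟨k + N + M, fun n hn => ?_⟩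
    obtain ⟨m, rfl⟩ := Nat.exists_eq_add_of_le (show k ≤ n by omega)
    have hm := hN m (by omega)
    have hμm : 0 < μ.real (PiNat.cylinder ω m) := hpos' 0 m
    have h1 : K * μ.real (PiNat.cylinder ω m) ≤
        Real.exp (δ / 2 * m) * ν.real (PiNat.cylinder ω (k + m)) := by
      calc K * μ.real (PiNat.cylinder ω m)
          ≤ K * (Real.exp (δ / 4 * m) * ∏ j ∈ Finset.range m, pastQuotient μ k (shift^[j] ω)) :=
            mul_le_mul_of_nonneg_left hm hK0.le
        _ = Real.exp (δ / 4 * m) * (K * ∏ j ∈ Finset.range m, pastQuotient μ k (shift^[j] ω)) := by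
            ring
        _ ≤ Real.exp (δ / 4 * m) * (Real.exp (δ / 4 * m) * ν.real (PiNat.cylinder ω (k + m))) :=
            mul_le_mul_of_nonneg_left (hlow m) (Real.exp_pos _).le
        _ = Real.exp (δ / 2 * m) * ν.real (PiNat.cylinder ω (k + m)) := by
            rw [← mul_assoc, ← Real.exp_add]; congr 2; ring
    refine ⟨?_, ?_⟩
    · have := (mul_pos hK0 hμm).trans_le h1
      exact pos_of_mul_pos_right this (Real.exp_pos _).le
    · have h2 : Real.exp (-(δ / 2 * m)) ≤ K := by
        rw [← Real.le_log_iff_exp_le hK0]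
        have h3 := (div_le_iff₀ (half_pos hδ)).1 hM
        have h4 : (M : ℝ) ≤ m := by exact_mod_cast (by omega : M ≤ m)
        nlinarith
      -- The estimates pair `μ` at length `m` with `ν` at length `k + m`; monotonicity of cylinders
      -- removes the mismatch.
      have h3 : μ.real (PiNat.cylinder ω (k + m)) ≤ μ.real (PiNat.cylinder ω m) :=
        measureReal_mono (PiNat.cylinder_anti ω (by omega))
      have h4 : μ.real (PiNat.cylinder ω m) ≤
          Real.exp (δ * m) * ν.real (PiNat.cylinder ω (k + m)) := by
        have h5 := (mul_le_mul_of_nonneg_right h2 hμm.le).trans h1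
        have h6 := mul_le_mul_of_nonneg_left h5 (Real.exp_pos (δ / 2 * m)).le
        rw [← mul_assoc, ← mul_assoc, ← Real.exp_add, ← Real.exp_add, add_neg_cancel,
          Real.exp_zero, one_mul] at h6
        refine h6.trans_eq ?_
        congr 2; ring
      refine (h3.trans h4).trans (mul_le_mul_of_nonneg_right (Real.exp_le_exp.2 ?_)
        measureReal_nonneg)
      push_cast
      nlinarith [mul_nonneg hδ.le (Nat.cast_nonneg (α := ℝ) k)]
  filter_upwards [hmain, hup] with n ⟨h1, h2⟩ h3
  have h0 : 0 < μ.real (PiNat.cylinder ω n) := hpos' 0 n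
  refine ⟨h0, h1, abs_le.2 ⟨?_, ?_⟩⟩
  · rw [Real.le_log_iff_exp_le (div_pos h0 h1), Real.exp_neg, le_div_iff₀ h1,
      inv_mul_le_iff₀ (Real.exp_pos _)]
    exact h3
  · rw [Real.log_le_iff_le_exp (div_pos h0 h1), div_le_iff₀ h1]
    exact h2

lemma witnessesRelDimSeparability_rationalMarkovMeasures {ρ : (ℕ → A) → (ℕ → A) → ℝ}
    (hρ : IsMetric ρ) (hform : IsGeometricPrefixForm ρ) :
    WitnessesRelDimSeparability ρ (ergodicMeasures A) (rationalMarkovMeasures A) where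
  countable := countable_rationalMarkovMeasures
  finite ν hν := have := hν.1.1; inferInstance
  approx μ hμ ε hε := by
    obtain ⟨δ, hδ, h⟩ := exists_relDim_lt (A := A) hρ hform hε
    obtain ⟨ν, hν, hae⟩ := exists_rationalMarkovMeasure_approx hμ hδ
    have := hμ.1
    have := hν.1.1
    exact ⟨ν, hν, h μ ν hae⟩

end RelativeDimension

open RelativeDimension
theorem proposition3p3 {A : Type*} [Finite A] [TopologicalSpace A] [DiscreteTopology A]
    [MeasurableSpace A] [BorelSpace A] :
    (∀ ρ : (ℕ → A) → (ℕ → A) → ℝ, IsMetric ρ → IsGeometricPrefixForm ρ →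
      RelDimSeparable ρ (ergodicMeasures A) ∧
      WitnessesRelDimSeparability ρ (ergodicMeasures A) (rationalMarkovMeasures A)) ∧
    (∀ (n : ℕ) (V : Set (EuclideanSpace ℝ (Fin n)))
      (f : A → EuclideanSpace ℝ (Fin n) → EuclideanSpace ℝ (Fin n)), IsConformalIFS V f →
      IsMetric (ifsMetric V f) ∧ IsGeometricPrefixForm (ifsMetric V f) ∧
      RelDimSeparable (ifsMetric V f) (ergodicMeasures A) ∧
      WitnessesRelDimSeparability (ifsMetric V f) (ergodicMeasures A)
        (rationalMarkovMeasures A)) := by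
  refine ⟨fun ρ hρ hform => ?_, fun n V f hf => ?_⟩
  · have h := witnessesRelDimSeparability_rationalMarkovMeasures hρ hform
    exact ⟨⟨_, h⟩, h⟩
  · have h := witnessesRelDimSeparability_rationalMarkovMeasures hf.isMetric_ifsMetric
      hf.isGeometricPrefixForm_ifsMetric
    exact ⟨hf.isMetric_ifsMetric, hf.isGeometricPrefixForm_ifsMetric, ⟨_, h⟩, h⟩
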